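/- Let $P(y)=a_1y+a_2y^2+\dots+a_ny^n$ be a real polynomial with $P(0)=0$ (with $a_k=0$ for $k>n$), and consider the planar Abel system $$\dot x=-y,\qquad \dot y=x\,(1+P(y)).$$ A cycle is the orbit of a non-constant periodic solution; $C(\gamma)$ denotes the bounded region enclosed by a cycle $\gamma$ and $T(\gamma)$ its minimal period. A center is an isolated singular point with a punctured neighborhood covered by cycles surrounding it; its period annulus is the largest connected punctured neighborhood covered by such cycles; the center is isochronous if all cycles in its period annulus have the same minimal period. The period function is increasing (decreasing) at the origin $O$ if there is a neighborhood $V$ of $O$ such that $T(\gamma_1)<T(\gamma_2)$ (respectively $T(\gamma_1)>T(\gamma_2)$) for all cycles $\gamma_1,\gamma_2\subset V$ surrounding $O$ with $C(\gamma_1)\subsetneq C(\gamma_2)$. For $x$ near $0$ put $$\phi(x)=\int_0^x\frac{ds}{1+P(s)},\qquad \tfrac12 X(x)^2=\int_0^x\frac{s}{1+P(s)}\,ds,$$ where $X(x)$ is taken with the sign of $x$. Then: 1. The origin $O$ is a center of the system. 2. If $a_1^2-3a_2>0$, the period function is increasing at $O$; if $a_1^2-3a_2<0$, it is decreasing at $O$.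 3. The center $O$ is isochronous if and only if there is an odd function $h$ such that, for all $x$ in a neighborhood of $0$, $$\frac{X(x)}{1+h(X(x))}=x,\qquad \phi(x)=X(x)+\int_0^{X(x)}h(t)\,dt,$$ and $X(x)\phi(x)>0$ for $x\ne0$ (the denominators being nonzero and the integrals existing). 4. If $P$ is even, i.e. $P(-y)=P(y)$, then $O$ is an isochronous center if and only if $P=0$. -/

import Mathlib

open Set Filter Topology

noncomputable section

/-- `γ` is a cycle of the autonomous planar system `u' = F u`, with minimal period `T`: it is the
orbit of a non-constant periodic solution whose least positive period is `T`. (A constant solution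
has no least positive period, so it is excluded by the minimality clause.) -/
def IsCycleWithPeriod (F : ℝ × ℝ → ℝ × ℝ) (γ : Set (ℝ × ℝ)) (T : ℝ) : Prop :=
  ∃ u : ℝ → ℝ × ℝ, IsIntegralCurve u (fun _ => F) ∧ 0 < T ∧ Function.Periodic u T ∧
    (∀ s, 0 < s → s < T → ¬ Function.Periodic u s) ∧ γ = range u

/-- The region bounded by a closed curve `γ`: the points off `γ` whose connected component in the
complement of `γ` is bounded. -/
def interiorRegion (γ : Set (ℝ × ℝ)) : Set (ℝ × ℝ) :=
  {q | q ∉ γ ∧ Bornology.IsBounded (connectedComponentIn γᶜ q)}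

/-- The points lying on some cycle of `u' = F u` that surrounds `p`. -/
def onCycleSurrounding (F : ℝ × ℝ → ℝ × ℝ) (p : ℝ × ℝ) : Set (ℝ × ℝ) :=
  {q | ∃ γ T, IsCycleWithPeriod F γ T ∧ p ∈ interiorRegion γ ∧ q ∈ γ}

/-- `p` is a center of `u' = F u`: an isolated singular point with a punctured neighborhood
covered by cycles surrounding `p`. -/
def IsCenter (F : ℝ × ℝ → ℝ × ℝ) (p : ℝ × ℝ) : Prop :=
  F p = 0 ∧ (∀ᶠ q in 𝓝[≠] p, F q ≠ 0) ∧ ∀ᶠ q in 𝓝[≠] p, q ∈ onCycleSurrounding F p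

/-- The period annulus of `p`: the largest connected punctured neighborhood of `p` covered by
cycles surrounding `p`. -/
def periodAnnulus (F : ℝ × ℝ → ℝ × ℝ) (p : ℝ × ℝ) : Set (ℝ × ℝ) :=
  connectedComponentIn (insert p (onCycleSurrounding F p)) p \ {p}

/-- `p` is an isochronous center: all cycles in its period annulus have the same minimal period. -/
def IsIsochronousCenter (F : ℝ × ℝ → ℝ × ℝ) (p : ℝ × ℝ) : Prop :=
  IsCenter F p ∧ ∃ T₀, ∀ γ T, IsCycleWithPeriod F γ T → γ ⊆ periodAnnulus F p → T = T₀

/-- The period function increases (strictly) near `p`: among the cycles surrounding `p` in some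
neighborhood of `p`, the minimal period increases strictly with the bounded region. -/
def PeriodIncreasesNear (F : ℝ × ℝ → ℝ × ℝ) (p : ℝ × ℝ) : Prop :=
  ∃ V ∈ 𝓝 p, ∀ γ₁ T₁ γ₂ T₂, IsCycleWithPeriod F γ₁ T₁ → IsCycleWithPeriod F γ₂ T₂ →
    γ₁ ⊆ V → γ₂ ⊆ V → p ∈ interiorRegion γ₁ → p ∈ interiorRegion γ₂ →
    interiorRegion γ₁ ⊂ interiorRegion γ₂ → T₁ < T₂

/-- The period function decreases (strictly) near `p`. -/
def PeriodDecreasesNear (F : ℝ × ℝ → ℝ × ℝ) (p : ℝ × ℝ) : Prop :=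
  ∃ V ∈ 𝓝 p, ∀ γ₁ T₁ γ₂ T₂, IsCycleWithPeriod F γ₁ T₁ → IsCycleWithPeriod F γ₂ T₂ →
    γ₁ ⊆ V → γ₂ ⊆ V → p ∈ interiorRegion γ₁ → p ∈ interiorRegion γ₂ →
    interiorRegion γ₁ ⊂ interiorRegion γ₂ → T₂ < T₁

/-- The vector field of the Abel system `x' = -y`, `y' = x (1 + P(y))`. -/
def abelField (P : Polynomial ℝ) (q : ℝ × ℝ) : ℝ × ℝ :=
  (-q.2, q.1 * (1 + P.eval q.2))

/-- `φ(x) = ∫₀ˣ ds / (1 + P(s))`, used for `x` close to `0`. -/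
def abelPhi (P : Polynomial ℝ) (x : ℝ) : ℝ :=
  ∫ s in (0 : ℝ)..x, 1 / (1 + P.eval s)

/-- The function `X`, used for `x` close to `0`, with `X(x)² / 2 = ∫₀ˣ s / (1 + P(s)) ds`, taken
with the sign of `x`. -/
def abelX (P : Polynomial ℝ) (x : ℝ) : ℝ :=
  Real.sign x * Real.sqrt (2 * ∫ s in (0 : ℝ)..x, s / (1 + P.eval s))

/-- `h` is a Urabe function of the Abel system: `h` is odd and, for all `x` in a neighborhood of
`0`, with `X = X(x)`, one has `X / (1 + h(X)) = x`, `φ(x) = X + ∫₀^X h` (where the integral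
exists), and `X φ(x) > 0` unless `x = 0`. -/
def IsAbelUrabeFunction (P : Polynomial ℝ) (h : ℝ → ℝ) : Prop :=
  Function.Odd h ∧ ∀ᶠ x in 𝓝 (0 : ℝ),
    1 + h (abelX P x) ≠ 0 ∧
    abelX P x / (1 + h (abelX P x)) = x ∧
    IntervalIntegrable h MeasureTheory.volume 0 (abelX P x) ∧
    abelPhi P x = abelX P x + ∫ t in (0 : ℝ)..(abelX P x), h t ∧
    (x ≠ 0 → 0 < abelX P x * abelPhi P x)

end

noncomputable section

/-! The change of variable v = X(y) turns the system into a rotation with variable speed. With Y the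
inverse of X and m(v) = Y(v)/v, the identities y = v m(v) and X'(y)(1 + P(y)) = m(v) give x' = -v
m(v), v' = x m(v). Hence the orbits in the strip are the circles x² + v² = r², and a full turn takes
T(r) = ∫₀^{2π} dθ / m(r sin θ) = ∫₀^π E(r sin θ) dθ, where E(v) = 1/m(v) + 1/m(-v) is `abelEven`.

Everything is read off E, which is analytic and even with E(0) = 2. Since E''(0) = (a₁² - 3a₂)/3,
the sign of a₁² - 3a₂ decides whether E, hence T, grows or decays near 0. The center is isochronous
iff E = 2 near 0 (`isIsochronousCenter_iff`): otherwise E' has no zeros on some (0, R) and T is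
strictly monotone there; conversely the identity theorem carries E = 2 to every cycle of the
annulus. The condition E = 2 says that h = 1/m - 1 is odd, and this h is the Urabe function. If P is
even, so is m; then E = 2 gives m = 1, X(y) = y and P = 0.

Two facts tie this to the general definitions of cycle and interior: a cycle around the origin
cannot leave the strip, because roots of 1 + P give invariant lines
(`IsCycleWithPeriod.mem_abelStrip`), and every cycle in the strip is one of the circles
(`IsCycleWithPeriod.eq_abelCircle`). -/

/-- The largest interval around `0` on which `1 + P` is positive. -/
def abelStrip (P : Polynomial ℝ) : Set ℝ :=
  ordConnectedComponent {y | 0 < 1 + P.eval y} 0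

/-- The potential `G(y) = ∫₀ʸ s / (1 + P(s)) ds`. -/
def abelG (P : Polynomial ℝ) (y : ℝ) : ℝ :=
  ∫ s in (0 : ℝ)..y, s / (1 + P.eval s)

/-! ### Primitives and analyticity. -/

theorem hasDerivAt_integral_of_continuousOn_of_ordConnected {s : Set ℝ} (hs : IsOpen s)
    (hc : s.OrdConnected) {f : ℝ → ℝ} (hf : ContinuousOn f s) {a b : ℝ} (ha : a ∈ s) (hb : b ∈ s) :
    HasDerivAt (fun u => ∫ x in a..u, f x) (f b) b :=
  intervalIntegral.integral_hasDerivAt_right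
    ((hf.mono (hc.uIcc_subset ha hb)).intervalIntegrable)
    (hf.stronglyMeasurableAtFilter hs b hb) (hf.continuousAt (hs.mem_nhds hb))

/-- A primitive of a rational function is analytic where the denominator does not vanish. -/
theorem analyticAt_of_hasDerivAt_polynomial_div {A B : Polynomial ℝ} {F : ℝ → ℝ} {c : ℝ}
    (hB : B.eval c ≠ 0) (hF : ∀ᶠ x in 𝓝 c, HasDerivAt F (A.eval x / B.eval x) x) :
    AnalyticAt ℝ F c := by
  -- The quotient is holomorphic on a complex disc around c, so it has a holomorphic primitive
  -- there; the real part of that primitive on the real axis differs from `F` by a constant.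
  set f : ℂ → ℂ := fun z => Polynomial.aeval z A / Polynomial.aeval z B with hfdef
  have hreal : ∀ (Q : Polynomial ℝ) (x : ℝ), Polynomial.aeval (x : ℂ) Q = ((Q.eval x : ℝ) : ℂ) := by
    intro Q x
    have := Polynomial.aeval_algebraMap_apply ℂ x Q
    simpa [Polynomial.aeval_def] using this
  have hB' : ∀ᶠ z : ℂ in 𝓝 (c : ℂ), Polynomial.aeval z B ≠ 0 := by
    have hcont : Continuous fun z : ℂ => Polynomial.aeval z B := B.continuous_aeval
    refine hcont.continuousAt.eventually_ne ?_
    rw [hreal]; exact_mod_cast hB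
  obtain ⟨r, hr, hball⟩ := Metric.eventually_nhds_iff_ball.1 hB'
  obtain ⟨r', hr', hball'⟩ := Metric.eventually_nhds_iff_ball.1 hF
  have hdiff : DifferentiableOn ℂ f (Metric.ball (c : ℂ) r) := by
    intro z hz
    exact ((A.differentiable_aeval z).div (B.differentiable_aeval z)
      (hball z hz)).differentiableWithinAt
  obtain ⟨g, hg⟩ := hdiff.isExactOn_ball
  have hgan : AnalyticAt ℂ g (c : ℂ) := by
    have : DifferentiableOn ℂ g (Metric.ball (c : ℂ) r) := fun z hz =>
      (hg z hz).differentiableAt.differentiableWithinAt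
    exact this.analyticAt (Metric.ball_mem_nhds _ hr)
  have hgre : AnalyticAt ℝ (fun x : ℝ => (g x).re) c := by
    have h1 : AnalyticAt ℝ (fun x : ℝ => (x : ℂ)) c := Complex.ofRealCLM.analyticAt c
    have h2 : AnalyticAt ℝ g (c : ℂ) := hgan.restrictScalars
    have h3 : AnalyticAt ℝ (fun z : ℂ => z.re) (g c) := Complex.reCLM.analyticAt _
    exact AnalyticAt.fun_comp (f := fun x : ℝ => g x) h3 (AnalyticAt.fun_comp h2 h1)
  have hgder : ∀ x ∈ Metric.ball c r,
      HasDerivAt (fun x : ℝ => (g x).re) (A.eval x / B.eval x) x := by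
    intro x hx
    have hx' : (x : ℂ) ∈ Metric.ball (c : ℂ) r := by
      simpa [Complex.dist_eq, ← Complex.ofReal_sub, Complex.norm_real, Real.dist_eq] using hx
    have := (hg _ hx').real_of_complex
    simp only [hfdef, hreal, ← Complex.ofReal_div, Complex.ofReal_re] at this
    exact this
  have hloc : ∀ x ∈ Metric.ball c (min r r'), F x = (g x).re + (F c - (g c).re) := by
    intro x hx
    have hd : ∀ y ∈ Metric.ball c (min r r'),
        HasDerivAt (fun x : ℝ => F x - (g x).re) 0 y := by
      intro y hy
      have h1 := hball' y (Metric.ball_subset_ball (min_le_right _ _) hy)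
      have h2 := hgder y (Metric.ball_subset_ball (min_le_left _ _) hy)
      have h3 := h1.fun_sub h2
      rwa [sub_self] at h3
    have := Metric.isOpen_ball.is_const_of_deriv_eq_zero
      (convex_ball c (min r r')).isPreconnected
      (fun y hy => (hd y hy).differentiableAt.differentiableWithinAt)
      (fun y hy => (hd y hy).deriv) hx (Metric.mem_ball_self (lt_min hr hr'))
    linarith
  refine (hgre.fun_add (analyticAt_const (v := F c - (g c).re))).congr ?_
  filter_upwards [Metric.ball_mem_nhds c (lt_min hr hr')] with x hx using (hloc x hx).symm

theorem AnalyticAt.dslope_same {f : ℝ → ℝ} {a : ℝ} (hf : AnalyticAt ℝ f a) :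
    AnalyticAt ℝ (dslope f a) a := by
  obtain ⟨p, hp⟩ := hf
  exact ⟨_, hp.has_fpower_series_dslope_fslope⟩

theorem AnalyticAt.dslope_of_ne {f : ℝ → ℝ} {a b : ℝ} (hf : AnalyticAt ℝ f b) (h : b ≠ a) :
    AnalyticAt ℝ (dslope f a) b := by
  have : AnalyticAt ℝ (fun x => (x - a)⁻¹ * (f x - f a)) b := by
    refine AnalyticAt.mul (AnalyticAt.inv (by fun_prop) (sub_ne_zero.2 h)) (hf.sub analyticAt_const)
  refine this.congr ?_
  filter_upwards [dslope_eventuallyEq_slope_of_ne f h] with x hx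
  rw [hx, slope_def_field]; ring

theorem AnalyticAt.real_sqrt {f : ℝ → ℝ} {a : ℝ} (hf : AnalyticAt ℝ f a) (h : f a ≠ 0) :
    AnalyticAt ℝ (fun x => √(f x)) a :=
  AnalyticAt.fun_comp (g := Real.sqrt) (Real.contDiffAt_sqrt (n := ⊤) h).analyticAt hf

/-! ### The potential G and the coordinate X on the strip. -/

section Strip
variable {P : Polynomial ℝ}

theorem zero_mem_abelStrip (hP : P.coeff 0 = 0) : (0 : ℝ) ∈ abelStrip P := by
  have : P.eval 0 = 0 := by rw [← Polynomial.coeff_zero_eq_eval_zero, hP]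
  rw [abelStrip, self_mem_ordConnectedComponent]
  simp [this]

theorem ordConnected_abelStrip : (abelStrip P).OrdConnected := by
  rw [abelStrip]; infer_instance

theorem one_add_eval_pos {y : ℝ} (hy : y ∈ abelStrip P) : 0 < 1 + P.eval y :=
  ordConnectedComponent_subset (s := {y | 0 < 1 + P.eval y}) hy

theorem isOpen_abelStrip : IsOpen (abelStrip P) := by
  rw [isOpen_iff_mem_nhds]
  intro y hy
  have h := one_add_eval_pos hy
  rw [abelStrip, ordConnectedComponent_eq (mem_ordConnectedComponent.1 hy),
    ordConnectedComponent_mem_nhds]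
  exact (isOpen_lt continuous_const (by fun_prop)).mem_nhds h

theorem continuousOn_div_one_add_eval {f : ℝ → ℝ} (hf : Continuous f) :
    ContinuousOn (fun s => f s / (1 + P.eval s)) (abelStrip P) :=
  hf.continuousOn.div (by fun_prop) fun _ hs => (one_add_eval_pos hs).ne'

theorem hasDerivAt_abelG (hP : P.coeff 0 = 0) {y : ℝ} (hy : y ∈ abelStrip P) :
    HasDerivAt (abelG P) (y / (1 + P.eval y)) y :=
  hasDerivAt_integral_of_continuousOn_of_ordConnected isOpen_abelStrip ordConnected_abelStrip
    (continuousOn_div_one_add_eval continuous_id) (zero_mem_abelStrip hP) hy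

theorem hasDerivAt_abelPhi (hP : P.coeff 0 = 0) {y : ℝ} (hy : y ∈ abelStrip P) :
    HasDerivAt (abelPhi P) (1 / (1 + P.eval y)) y :=
  hasDerivAt_integral_of_continuousOn_of_ordConnected isOpen_abelStrip ordConnected_abelStrip
    (continuousOn_div_one_add_eval continuous_const) (zero_mem_abelStrip hP) hy

theorem analyticAt_abelG (hP : P.coeff 0 = 0) {y : ℝ} (hy : y ∈ abelStrip P) :
    AnalyticAt ℝ (abelG P) y := by
  refine analyticAt_of_hasDerivAt_polynomial_div (A := Polynomial.X) (B := 1 + P)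
    (by simpa using (one_add_eval_pos hy).ne') ?_
  filter_upwards [isOpen_abelStrip.mem_nhds hy] with x hx
  simpa using hasDerivAt_abelG hP hx

theorem abelG_zero : abelG P 0 = 0 := by simp [abelG]

theorem abelG_pos (hP : P.coeff 0 = 0) {y : ℝ} (hy : y ∈ abelStrip P) (h0 : y ≠ 0) :
    0 < abelG P y := by
  have hsub := ordConnected_abelStrip.uIcc_subset (zero_mem_abelStrip hP) hy
  have hint := ((continuousOn_div_one_add_eval (P := P) continuous_id).mono hsub).intervalIntegrable
    (μ := MeasureTheory.volume)
  rcases lt_or_gt_of_ne h0 with h | h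
  · rw [abelG, intervalIntegral.integral_symm, ← intervalIntegral.integral_neg]
    refine intervalIntegral.intervalIntegral_pos_of_pos_on hint.symm.neg ?_ h
    intro s hs
    have : 0 < 1 + P.eval s := one_add_eval_pos (hsub ⟨by simp [hs.1.le], by simp [hs.2.le]⟩)
    have : s / (1 + P.eval s) < 0 := div_neg_of_neg_of_pos hs.2 this
    simpa using this
  · refine intervalIntegral.intervalIntegral_pos_of_pos_on hint ?_ h
    intro s hs
    have : 0 < 1 + P.eval s := one_add_eval_pos (hsub ⟨by simp [hs.1.le], by simp [hs.2.le]⟩)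
    exact div_pos hs.1 this

theorem abelX_eq (y : ℝ) : abelX P y = Real.sign y * √(2 * abelG P y) := rfl

theorem abelX_zero : abelX P 0 = 0 := by simp [abelX]

theorem abelX_sq (hP : P.coeff 0 = 0) {y : ℝ} (hy : y ∈ abelStrip P) :
    abelX P y ^ 2 = 2 * abelG P y := by
  rcases eq_or_ne y 0 with rfl | h
  · simp [abelX_zero, abelG_zero]
  · rw [abelX_eq, mul_pow, Real.sq_sqrt (by linarith [abelG_pos hP hy h])]
    rcases Real.sign_apply_eq_of_ne_zero y h with h | h <;> rw [h] <;> ring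

theorem mul_abelX_pos (hP : P.coeff 0 = 0) {y : ℝ} (hy : y ∈ abelStrip P) (h0 : y ≠ 0) :
    0 < y * abelX P y := by
  have : 0 < √(2 * abelG P y) := Real.sqrt_pos.2 (by linarith [abelG_pos hP hy h0])
  rw [abelX_eq, ← mul_assoc]
  refine mul_pos ?_ this
  rw [mul_comm]; exact Real.sign_mul_pos_of_ne_zero y h0

theorem abelX_ne_zero (hP : P.coeff 0 = 0) {y : ℝ} (hy : y ∈ abelStrip P) (h0 : y ≠ 0) :
    abelX P y ≠ 0 := right_ne_zero_of_mul (mul_abelX_pos hP hy h0).ne'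

/-- G has a double zero at 0, so G = y² g₂ with g₂(0) = 1/2, and the sign in X cancels against √(y²)
= |y|. This is what makes X analytic across 0. -/
theorem abelX_eventuallyEq_mul_sqrt (hP : P.coeff 0 = 0) :
    ∃ g : ℝ → ℝ, AnalyticAt ℝ g 0 ∧ g 0 = 1 ∧ ∀ᶠ y in 𝓝 0, abelX P y = y * g y := by
  have h0 := zero_mem_abelStrip hP
  have hG := analyticAt_abelG hP h0
  have heval : P.eval 0 = 0 := by rw [← Polynomial.coeff_zero_eq_eval_zero, hP]
  set g₂ := dslope (dslope (abelG P) 0) 0 with hg₂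
  have hg₂an : AnalyticAt ℝ g₂ 0 := hG.dslope_same.dslope_same
  have hd0 : dslope (abelG P) 0 0 = 0 := by
    rw [dslope_same, (hasDerivAt_abelG hP h0).deriv]; simp
  have hfac : ∀ y, abelG P y = y * (y * g₂ y) := by
    intro y
    have e1 := sub_smul_dslope (abelG P) 0 y
    have e2 := sub_smul_dslope (dslope (abelG P) 0) 0 y
    simp only [sub_zero, smul_eq_mul, abelG_zero, hd0] at e1 e2
    rw [← e1, ← e2]
  have hhalf : g₂ 0 = 1 / 2 := by
    -- Differentiating G = y² g₂ and dividing by y ≠ 0 shows that this function vanishes on a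
    -- punctured neighborhood; continuity then gives 2 g₂(0) = 1.
    have hcont : ContinuousAt (fun y => 2 * g₂ y + y * deriv g₂ y - 1 / (1 + P.eval y)) 0 := by
      have := hg₂an.continuousAt
      have := hg₂an.deriv.continuousAt
      refine ContinuousAt.sub (by fun_prop) (ContinuousAt.div (by fun_prop) (by fun_prop) ?_)
      simp [heval]
    have hev : ∀ᶠ y in 𝓝[≠] (0 : ℝ), 2 * g₂ y + y * deriv g₂ y - 1 / (1 + P.eval y) = 0 := by
      filter_upwards [nhdsWithin_le_nhds hg₂an.eventually_analyticAt,
        nhdsWithin_le_nhds (isOpen_abelStrip.mem_nhds h0), self_mem_nhdsWithin] with y hy hyI hy0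
      have hg' := hy.differentiableAt.hasDerivAt
      have e1 := ((hasDerivAt_id y).mul ((hasDerivAt_id y).mul hg')).unique
        ((hasDerivAt_abelG hP hyI).congr_of_eventuallyEq (Eventually.of_forall fun z => by
          simp [hfac z]))
      have hy0' : y ≠ 0 := hy0
      have hp := (one_add_eval_pos hyI).ne'
      simp only [id, Pi.mul_apply] at e1
      refine mul_left_cancel₀ hy0' ?_
      have : y / (1 + P.eval y) = y * (1 / (1 + P.eval y)) := by ring
      rw [this] at e1
      linear_combination e1
    have hlim := (hcont.tendsto.mono_left nhdsWithin_le_nhds).congr' hev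
    have := tendsto_nhds_unique hlim tendsto_const_nhds
    simp [heval] at this
    linarith
  have hpos : ∀ᶠ y in 𝓝 (0 : ℝ), 0 < g₂ y :=
    hg₂an.continuousAt.eventually_const_lt (by rw [hhalf]; norm_num)
  refine ⟨fun y => √(2 * g₂ y), (analyticAt_const.mul hg₂an).real_sqrt (by simp [hhalf]),
    by simp [hhalf], ?_⟩
  filter_upwards [hpos] with y hy
  rw [abelX_eq, hfac, show 2 * (y * (y * g₂ y)) = y ^ 2 * (2 * g₂ y) by ring,
    Real.sqrt_mul (sq_nonneg y), Real.sqrt_sq_eq_abs, ← mul_assoc]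
  congr 1
  rcases lt_trichotomy y 0 with h | rfl | h
  · rw [Real.sign_of_neg h, abs_of_neg h]; ring
  · simp
  · rw [Real.sign_of_pos h, abs_of_pos h]; ring

theorem analyticAt_abelX (hP : P.coeff 0 = 0) {y : ℝ} (hy : y ∈ abelStrip P) :
    AnalyticAt ℝ (abelX P) y := by
  rcases eq_or_ne y 0 with rfl | h
  · obtain ⟨g, hg, -, he⟩ := abelX_eventuallyEq_mul_sqrt hP
    exact (analyticAt_id.mul hg).congr (he.mono fun y hy => hy.symm)
  · have hG := abelG_pos hP hy h
    have := (analyticAt_const (v := Real.sign y)).mul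
      ((analyticAt_const.mul (analyticAt_abelG hP hy)).real_sqrt (by positivity : 2 * abelG P y ≠ 0))
    refine this.congr ?_
    rcases lt_or_gt_of_ne h with h | h
    · filter_upwards [gt_mem_nhds h] with z hz
      simp [abelX_eq, Real.sign_of_neg hz, Real.sign_of_neg h]
    · filter_upwards [lt_mem_nhds h] with z hz
      simp [abelX_eq, Real.sign_of_pos hz, Real.sign_of_pos h]

theorem continuousOn_abelX (hP : P.coeff 0 = 0) : ContinuousOn (abelX P) (abelStrip P) :=
  fun _ hy => (analyticAt_abelX hP hy).continuousAt.continuousWithinAt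

theorem deriv_abelX_zero (hP : P.coeff 0 = 0) : deriv (abelX P) 0 = 1 := by
  obtain ⟨g, hg, h1, he⟩ := abelX_eventuallyEq_mul_sqrt hP
  have := ((hasDerivAt_id (0 : ℝ)).mul hg.differentiableAt.hasDerivAt).congr_of_eventuallyEq
    (f₁ := abelX P) (he.mono fun y hy => by simp [hy])
  simpa [h1] using this.deriv

theorem abelX_mul_deriv (hP : P.coeff 0 = 0) {y : ℝ} (hy : y ∈ abelStrip P) :
    abelX P y * deriv (abelX P) y * (1 + P.eval y) = y := by
  have h1 := (analyticAt_abelX hP hy).differentiableAt.hasDerivAt.pow 2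
  have h2 := (hasDerivAt_abelG hP hy).const_mul 2
  have h3 : (abelX P) ^ 2 =ᶠ[𝓝 y] fun z => 2 * abelG P z := by
    filter_upwards [isOpen_abelStrip.mem_nhds hy] with z hz
    exact abelX_sq hP hz
  have := h1.unique (h2.congr_of_eventuallyEq h3)
  have hp := (one_add_eval_pos hy).ne'
  field_simp at this
  norm_num at this
  linarith

theorem deriv_abelX_pos (hP : P.coeff 0 = 0) {y : ℝ} (hy : y ∈ abelStrip P) :
    0 < deriv (abelX P) y := by
  rcases eq_or_ne y 0 with rfl | h
  · rw [deriv_abelX_zero hP]; norm_num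
  · have h1 := abelX_mul_deriv hP hy
    have h2 := one_add_eval_pos hy
    have h3 := mul_abelX_pos hP hy h
    by_contra! hneg
    have h5 : y * y = (y * abelX P y) * deriv (abelX P) y * (1 + P.eval y) := by
      linear_combination -y * h1
    have h6 : 0 < y * y := mul_self_pos.2 h
    have h7 := mul_nonpos_of_nonpos_of_nonneg
      (mul_nonpos_of_nonneg_of_nonpos h3.le hneg) h2.le
    linarith

theorem strictMonoOn_abelX (hP : P.coeff 0 = 0) : StrictMonoOn (abelX P) (abelStrip P) := by
  refine strictMonoOn_of_deriv_pos ordConnected_abelStrip.convex (continuousOn_abelX hP) ?_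
  intro y hy
  exact deriv_abelX_pos hP (interior_subset hy)

end Strip

/-! ### The inverse Y and the angular speed m. -/

/-- The range of `X` on the strip. -/
def abelRange (P : Polynomial ℝ) : Set ℝ := abelX P '' abelStrip P

/-- The inverse of `X` on its range. -/
def abelY (P : Polynomial ℝ) : ℝ → ℝ := Function.invFunOn (abelX P) (abelStrip P)

/-- The angular speed `Y(v) / v` of the flow in the coordinates `(x, X(y))`. -/
def abelSpeed (P : Polynomial ℝ) : ℝ → ℝ := dslope (abelY P) 0

section Inverse
variable {P : Polynomial ℝ}

theorem abelX_mem_range {y : ℝ} (hy : y ∈ abelStrip P) : abelX P y ∈ abelRange P :=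
  mem_image_of_mem _ hy

theorem abelY_mem {v : ℝ} (hv : v ∈ abelRange P) : abelY P v ∈ abelStrip P :=
  Function.invFunOn_mem hv

theorem abelX_abelY {v : ℝ} (hv : v ∈ abelRange P) : abelX P (abelY P v) = v :=
  Function.invFunOn_eq hv

theorem abelY_abelX (hP : P.coeff 0 = 0) {y : ℝ} (hy : y ∈ abelStrip P) :
    abelY P (abelX P y) = y :=
  (strictMonoOn_abelX hP).injOn.leftInvOn_invFunOn hy

theorem zero_mem_abelRange (hP : P.coeff 0 = 0) : (0 : ℝ) ∈ abelRange P :=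
  ⟨0, zero_mem_abelStrip hP, abelX_zero⟩

theorem abelY_zero (hP : P.coeff 0 = 0) : abelY P 0 = 0 := by
  have := abelY_abelX hP (zero_mem_abelStrip hP)
  rwa [abelX_zero] at this

theorem isOpen_abelRange (hP : P.coeff 0 = 0) : IsOpen (abelRange P) := by
  rw [isOpen_iff_mem_nhds]
  rintro _ ⟨y, hy, rfl⟩
  rw [← ((analyticAt_abelX hP hy).hasStrictDerivAt).map_nhds_eq (deriv_abelX_pos hP hy).ne']
  exact image_mem_map (isOpen_abelStrip.mem_nhds hy)

theorem ordConnected_abelRange (hP : P.coeff 0 = 0) : (abelRange P).OrdConnected :=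
  (ordConnected_abelStrip.isPreconnected.image _ (continuousOn_abelX hP)).ordConnected

theorem analyticAt_abelY (hP : P.coeff 0 = 0) {v : ℝ} (hv : v ∈ abelRange P) :
    AnalyticAt ℝ (abelY P) v := by
  obtain ⟨y, hy, rfl⟩ := hv
  -- Regularity `⊤` means analytic here, so the inverse function theorem yields an analytic local
  -- inverse. Near the image of `y` it takes values in the strip, where X is injective, so it agrees
  -- with `abelY`.
  have hX : ContDiffAt ℝ ⊤ (abelX P) y := (analyticAt_abelX hP hy).contDiffAt
  have hd := (deriv_abelX_pos hP hy).ne'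
  have hF : HasFDerivAt (abelX P)
      (ContinuousLinearEquiv.unitsEquivAut ℝ (Units.mk0 _ hd) : ℝ →L[ℝ] ℝ) y :=
    (analyticAt_abelX hP hy).differentiableAt.hasDerivAt.hasFDerivAt_equiv hd
  have hstrict := hX.hasStrictFDerivAt' hF (by simp)
  have han : AnalyticAt ℝ (hX.localInverse hF (by simp)) (abelX P y) :=
    (hX.to_localInverse hF (by simp)).analyticAt
  refine han.congr ?_
  have h1 : ∀ᶠ v in 𝓝 (abelX P y), abelX P (hX.localInverse hF (by simp) v) = v :=
    hstrict.eventually_right_inverse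
  have h2 : ∀ᶠ v in 𝓝 (abelX P y), hX.localInverse hF (by simp) v ∈ abelStrip P := by
    refine han.continuousAt.eventually_mem ?_
    rw [ContDiffAt.localInverse_apply_image]
    exact isOpen_abelStrip.mem_nhds hy
  filter_upwards [h1, h2] with v hv1 hv2
  conv_rhs => rw [← hv1]
  rw [abelY_abelX hP hv2]

theorem continuousOn_abelY (hP : P.coeff 0 = 0) : ContinuousOn (abelY P) (abelRange P) :=
  fun _ hv => (analyticAt_abelY hP hv).continuousAt.continuousWithinAt

theorem deriv_abelY (hP : P.coeff 0 = 0) {v : ℝ} (hv : v ∈ abelRange P) :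
    deriv (abelX P) (abelY P v) * deriv (abelY P) v = 1 := by
  have h1 := (analyticAt_abelX hP (abelY_mem hv)).differentiableAt.hasDerivAt.comp v
    (analyticAt_abelY hP hv).differentiableAt.hasDerivAt
  refine h1.unique ((hasDerivAt_id v).congr_of_eventuallyEq ?_)
  filter_upwards [(isOpen_abelRange hP).mem_nhds hv] with w hw using abelX_abelY hw

theorem mul_abelSpeed (hP : P.coeff 0 = 0) (v : ℝ) : v * abelSpeed P v = abelY P v := by
  have := sub_smul_dslope (abelY P) 0 v
  simpa [abelSpeed, abelY_zero hP] using this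

theorem abelSpeed_zero (hP : P.coeff 0 = 0) : abelSpeed P 0 = 1 := by
  have := deriv_abelY hP (zero_mem_abelRange hP)
  rw [abelY_zero hP, deriv_abelX_zero hP] at this
  rw [abelSpeed, dslope_same]; linarith

theorem analyticAt_abelSpeed (hP : P.coeff 0 = 0) {v : ℝ} (hv : v ∈ abelRange P) :
    AnalyticAt ℝ (abelSpeed P) v := by
  rcases eq_or_ne v 0 with rfl | h
  · exact (analyticAt_abelY hP hv).dslope_same
  · exact (analyticAt_abelY hP hv).dslope_of_ne h

theorem abelSpeed_pos (hP : P.coeff 0 = 0) {v : ℝ} (hv : v ∈ abelRange P) :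
    0 < abelSpeed P v := by
  rcases eq_or_ne v 0 with rfl | h
  · rw [abelSpeed_zero hP]; norm_num
  · have h1 := mul_abelSpeed hP v
    have h0 : abelY P v ≠ 0 := by
      intro h0
      have := abelX_abelY hv
      rw [h0, abelX_zero] at this
      exact h this.symm
    have h2 := mul_abelX_pos hP (abelY_mem hv) h0
    rw [abelX_abelY hv, ← h1] at h2
    have h3 : 0 < v * v := mul_self_pos.2 h
    by_contra! hneg
    nlinarith [mul_nonpos_of_nonneg_of_nonpos h3.le hneg]

theorem abelX_mul_abelSpeed (hP : P.coeff 0 = 0) {y : ℝ} (hy : y ∈ abelStrip P) :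
    abelX P y * abelSpeed P (abelX P y) = y := by
  rw [mul_abelSpeed hP, abelY_abelX hP hy]

/-- This turns y' = x(1 + P(y)) into v' = x m(v). It is X X'(1 + P) = y divided by X, with the point
0 checked by values. -/
theorem deriv_abelX_mul (hP : P.coeff 0 = 0) {y : ℝ} (hy : y ∈ abelStrip P) :
    deriv (abelX P) y * (1 + P.eval y) = abelSpeed P (abelX P y) := by
  rcases eq_or_ne y 0 with rfl | h
  · have heval : P.eval 0 = 0 := by rw [← Polynomial.coeff_zero_eq_eval_zero, hP]
    rw [deriv_abelX_zero hP, abelX_zero, abelSpeed_zero hP, heval]; norm_num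
  · refine mul_left_cancel₀ (abelX_ne_zero hP hy h) ?_
    rw [← mul_assoc, abelX_mul_deriv hP hy, abelX_mul_abelSpeed hP hy]

theorem deriv_abelY_mul (hP : P.coeff 0 = 0) {v : ℝ} (hv : v ∈ abelRange P) :
    deriv (abelY P) v * abelSpeed P v = 1 + P.eval (abelY P v) := by
  have h1 := deriv_abelX_mul hP (abelY_mem hv)
  have h2 := deriv_abelY hP hv
  rw [abelX_abelY hv] at h1
  rw [← h1]
  linear_combination (1 + P.eval (abelY P v)) * h2

end Inverse

/-! ### Time along the level curves, and the cycles in the strip. -/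

/-- The time needed to run through the angle `θ` on the circle of radius `r`. -/
def abelTime (P : Polynomial ℝ) (r θ : ℝ) : ℝ :=
  ∫ s in (0 : ℝ)..θ, (abelSpeed P (r * Real.sin s))⁻¹

/-- The period of the cycle of radius `r`. -/
def abelPeriod (P : Polynomial ℝ) (r : ℝ) : ℝ := abelTime P r (2 * Real.pi)

/-- The level curve of radius `r` of the first integral, parametrized by the angle. -/
def abelParam (P : Polynomial ℝ) (r θ : ℝ) : ℝ × ℝ :=
  (r * Real.cos θ, abelY P (r * Real.sin θ))

/-- The level curve `x² + X(y)² = r²`. -/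
def abelCircle (P : Polynomial ℝ) (r : ℝ) : Set (ℝ × ℝ) := range (abelParam P r)

/-- The region `x² + X(y)² < r²`. -/
def abelDisc (P : Polynomial ℝ) (r : ℝ) : Set (ℝ × ℝ) :=
  {q | q.2 ∈ abelStrip P ∧ q.1 ^ 2 + abelX P q.2 ^ 2 < r ^ 2}

theorem exists_eq_add_two_pi_of_cos_sin {a b : ℝ} (hc : Real.cos a = Real.cos b)
    (hs : Real.sin a = Real.sin b) : ∃ n : ℤ, b = a + n * (2 * Real.pi) := by
  obtain ⟨k, hk⟩ := Real.Angle.angle_eq_iff_two_pi_dvd_sub.1 (Real.Angle.cos_sin_inj hc hs)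
  exact ⟨-k, by push_cast; linarith⟩

theorem exists_polar_coordinates (x y : ℝ) :
    ∃ r θ : ℝ, 0 ≤ r ∧ x = r * Real.cos θ ∧ y = r * Real.sin θ ∧ x ^ 2 + y ^ 2 = r ^ 2 := by
  have h1 := Complex.norm_mul_cos_arg ⟨x, y⟩
  have h2 := Complex.norm_mul_sin_arg ⟨x, y⟩
  refine ⟨‖(⟨x, y⟩ : ℂ)‖, Complex.arg ⟨x, y⟩, norm_nonneg _, h1.symm, h2.symm, ?_⟩
  rw [Complex.sq_norm, Complex.normSq_mk]; ring

section Time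
variable {P : Polynomial ℝ} {r : ℝ}

/-- The recurring hypothesis `H` is admissibility of the radius: since sin takes all values in [-1,
1], it amounts to [-r, r] lying in the range of X. -/
theorem mem_abelRange_of_abs_le (hr : 0 < r) (H : ∀ θ, r * Real.sin θ ∈ abelRange P) {v : ℝ}
    (hv : |v| ≤ r) : v ∈ abelRange P := by
  have h := abs_le.1 hv
  have := H (Real.arcsin (v / r))
  rwa [Real.sin_arcsin (by rw [le_div_iff₀ hr]; linarith) (by rw [div_le_iff₀ hr]; linarith),
    mul_div_cancel₀ _ hr.ne'] at this

theorem continuous_abelSpeed_inv (hP : P.coeff 0 = 0) (H : ∀ θ, r * Real.sin θ ∈ abelRange P) :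
    Continuous fun s => (abelSpeed P (r * Real.sin s))⁻¹ := by
  refine Continuous.inv₀ ?_ fun s => (abelSpeed_pos hP (H s)).ne'
  refine continuous_iff_continuousAt.2 fun s => ?_
  exact ContinuousAt.comp (f := fun s => r * Real.sin s) (analyticAt_abelSpeed hP (H s)).continuousAt
    (by fun_prop)

theorem hasDerivAt_abelTime (hP : P.coeff 0 = 0) (H : ∀ θ, r * Real.sin θ ∈ abelRange P) (θ : ℝ) :
    HasDerivAt (abelTime P r) (abelSpeed P (r * Real.sin θ))⁻¹ θ :=
  (continuous_abelSpeed_inv hP H).integral_hasStrictDerivAt 0 θ |>.hasDerivAt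

theorem strictMono_abelTime (hP : P.coeff 0 = 0) (H : ∀ θ, r * Real.sin θ ∈ abelRange P) :
    StrictMono (abelTime P r) := by
  refine strictMono_of_deriv_pos fun θ => ?_
  rw [(hasDerivAt_abelTime hP H θ).deriv]
  exact inv_pos.2 (abelSpeed_pos hP (H θ))

theorem abelTime_zero : abelTime P r 0 = 0 := by simp [abelTime]

theorem abelPeriod_pos (hP : P.coeff 0 = 0) (H : ∀ θ, r * Real.sin θ ∈ abelRange P) :
    0 < abelPeriod P r := by
  have := strictMono_abelTime hP H Real.two_pi_pos
  rwa [abelTime_zero] at this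

theorem abelTime_add_int_mul (hP : P.coeff 0 = 0) (H : ∀ θ, r * Real.sin θ ∈ abelRange P)
    (θ : ℝ) (n : ℤ) :
    abelTime P r (θ + n * (2 * Real.pi)) = abelTime P r θ + n * abelPeriod P r := by
  have hc := continuous_abelSpeed_inv hP H
  have hper : Function.Periodic (fun s => (abelSpeed P (r * Real.sin s))⁻¹) (2 * Real.pi) := by
    intro s; simp [Real.sin_add_two_pi]
  have h1 : ∀ θ, abelTime P r (θ + 2 * Real.pi) = abelTime P r θ + abelPeriod P r := by
    intro θ
    have h := hper.intervalIntegral_add_eq θ 0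
    rw [zero_add] at h
    rw [abelPeriod, abelTime, abelTime, abelTime, ← h,
      intervalIntegral.integral_add_adjacent_intervals (hc.intervalIntegrable _ _)
        (hc.intervalIntegrable _ _)]
  -- Removing the linear drift leaves a 2π-periodic function, which handles all integers `n` at
  -- once.
  have h2 : Function.Periodic
      (fun θ => abelTime P r θ - abelPeriod P r * (θ / (2 * Real.pi))) (2 * Real.pi) := by
    intro θ
    have := Real.two_pi_pos.ne'
    simp only [h1]
    field_simp
    ring
  have h3 := h2.int_mul n θ
  have := Real.two_pi_pos.ne'
  have h4 : (θ + n * (2 * Real.pi)) / (2 * Real.pi) = θ / (2 * Real.pi) + n := by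
    field_simp
  beta_reduce at h3
  rw [h4] at h3
  linarith

theorem continuous_abelTime (hP : P.coeff 0 = 0) (H : ∀ θ, r * Real.sin θ ∈ abelRange P) :
    Continuous (abelTime P r) :=
  continuous_iff_continuousAt.2 fun θ => (hasDerivAt_abelTime hP H θ).continuousAt

theorem surjective_abelTime (hP : P.coeff 0 = 0) (H : ∀ θ, r * Real.sin θ ∈ abelRange P) :
    Function.Surjective (abelTime P r) := by
  intro t
  have hT := abelPeriod_pos hP H
  have h1 : ∀ n : ℤ, abelTime P r (n * (2 * Real.pi)) = n * abelPeriod P r := fun n => by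
    have := abelTime_add_int_mul hP H 0 n
    rwa [zero_add, abelTime_zero, zero_add] at this
  obtain ⟨n, hn⟩ := exists_int_gt (t / abelPeriod P r)
  obtain ⟨m, hm⟩ := exists_int_lt (t / abelPeriod P r)
  rw [div_lt_iff₀ hT] at hn
  rw [lt_div_iff₀ hT] at hm
  exact mem_range_of_exists_le_of_exists_ge (continuous_abelTime hP H)
    ⟨_, (h1 m).trans_le hm.le⟩ ⟨_, hn.le.trans_eq (h1 n).symm⟩

/-- A point of the curve determines its angle modulo 2π, and each turn costs one `abelPeriod`. The
shift `c` lets this serve both the solution constructed below and an arbitrary cycle with its own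
initial phase. -/
theorem periodic_abelParam_comp_iff (hP : P.coeff 0 = 0) (hr : 0 < r)
    (H : ∀ θ, r * Real.sin θ ∈ abelRange P) {Θ : ℝ → ℝ} {c : ℝ}
    (hΘ : ∀ t, abelTime P r (Θ t) = t + c) (s : ℝ) :
    Function.Periodic (fun t => abelParam P r (Θ t)) s ↔ ∃ n : ℤ, s = n * abelPeriod P r := by
  constructor
  · intro h
    have h0 := h 0
    simp only [abelParam, Prod.mk.injEq] at h0
    have hs := congrArg (abelX P) h0.2
    rw [abelX_abelY (H _), abelX_abelY (H _)] at hs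
    obtain ⟨n, hn⟩ := exists_eq_add_two_pi_of_cos_sin (mul_left_cancel₀ hr.ne' h0.1.symm)
      (mul_left_cancel₀ hr.ne' hs.symm)
    refine ⟨n, ?_⟩
    have h1 := hΘ (0 + s)
    rw [hn, abelTime_add_int_mul hP H, hΘ] at h1
    linarith
  · rintro ⟨n, rfl⟩ t
    have : Θ (t + n * abelPeriod P r) = Θ t + n * (2 * Real.pi) := by
      apply (strictMono_abelTime hP H).injective
      rw [abelTime_add_int_mul hP H, hΘ, hΘ]; ring
    simp [abelParam, this, Real.cos_add_int_mul_two_pi, Real.sin_add_int_mul_two_pi]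

theorem range_abelParam_comp (hP : P.coeff 0 = 0) (H : ∀ θ, r * Real.sin θ ∈ abelRange P)
    {Θ : ℝ → ℝ} {c : ℝ} (hΘ : ∀ t, abelTime P r (Θ t) = t + c) :
    range (fun t => abelParam P r (Θ t)) = abelCircle P r := by
  have hsurj : Function.Surjective Θ := fun θ =>
    ⟨abelTime P r θ - c, (strictMono_abelTime hP H).injective (by rw [hΘ]; ring)⟩
  exact hsurj.range_comp (abelParam P r)

/-- Every admissible level curve is a cycle. -/
theorem isCycleWithPeriod_abelCircle (hP : P.coeff 0 = 0) (hr : 0 < r)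
    (H : ∀ θ, r * Real.sin θ ∈ abelRange P) :
    IsCycleWithPeriod (abelField P) (abelCircle P r) (abelPeriod P r) := by
  -- The inverse of `e` is the angle as a function of time; its derivative is the angular speed.
  set e := (strictMono_abelTime hP H).orderIsoOfSurjective _ (surjective_abelTime hP H)
  have he : ∀ t, abelTime P r (e.symm t) = t := fun t => e.apply_symm_apply t
  have he' : ∀ t, abelTime P r (e.symm t) = t + 0 := fun t => by rw [he, add_zero]
  have hT := abelPeriod_pos hP H
  have hper := periodic_abelParam_comp_iff hP hr H he'
  refine ⟨fun t => abelParam P r (e.symm t), ?_, hT, ?_, ?_, (range_abelParam_comp hP H he').symm⟩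
  · intro t
    have hm := abelSpeed_pos hP (H (e.symm t))
    have hd : HasDerivAt e.symm (abelSpeed P (r * Real.sin (e.symm t))) t := by
      have := HasDerivAt.of_local_left_inverse e.symm.continuous.continuousAt
        (hasDerivAt_abelTime hP H (e.symm t)) (inv_pos.2 hm).ne' (Eventually.of_forall he)
      rwa [inv_inv] at this
    have h1 := (hd.cos).const_mul r
    have h2 := (hd.sin).const_mul r
    have h3 := HasDerivAt.comp t (h₂ := abelY P)
      (analyticAt_abelY hP (H (e.symm t))).differentiableAt.hasDerivAt h2
    have h4 := h1.prodMk h3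
    refine h4.congr_deriv ?_
    simp only [abelField, abelParam, Prod.mk.injEq]
    constructor
    · rw [← mul_abelSpeed hP]; ring
    · rw [← deriv_abelY_mul hP (H (e.symm t))]; ring
  · exact (hper _).2 ⟨1, by simp⟩
  · intro s hs0 hsT h
    obtain ⟨n, rfl⟩ := (hper s).1 h
    have h1 : 0 < (n : ℝ) := pos_of_mul_pos_left hs0 hT.le
    have h2 : (n : ℝ) < 1 := by
      by_contra! hn
      nlinarith
    have h3 : 0 < n := by exact_mod_cast h1
    have h4 : n < 1 := by exact_mod_cast h2
    omega

/-- Every cycle in the strip is an admissible level curve. -/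
theorem IsCycleWithPeriod.eq_abelCircle (hP : P.coeff 0 = 0) {γ : Set (ℝ × ℝ)} {T : ℝ}
    (hγ : IsCycleWithPeriod (abelField P) γ T) (hS : ∀ q ∈ γ, q.2 ∈ abelStrip P) :
    ∃ r, 0 < r ∧ (∀ θ, r * Real.sin θ ∈ abelRange P) ∧ γ = abelCircle P r ∧
      T = abelPeriod P r := by
  obtain ⟨u, hu, hT, hper, hmin, rfl⟩ := hγ
  have hI : ∀ t, (u t).2 ∈ abelStrip P := fun t => hS _ (mem_range_self t)
  have hx : ∀ t, HasDerivAt (fun t => (u t).1) (-(u t).2) t := fun t => (hu t).fst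
  have hy : ∀ t, HasDerivAt (fun t => (u t).2) ((u t).1 * (1 + P.eval (u t).2)) t :=
    fun t => (hu t).snd
  set v : ℝ → ℝ := fun t => abelX P (u t).2 with hvdef
  set m : ℝ → ℝ := fun t => abelSpeed P (v t) with hmdef
  have hvm : ∀ t, v t ∈ abelRange P := fun t => abelX_mem_range (hI t)
  have hv : ∀ t, HasDerivAt v ((u t).1 * m t) t := by
    intro t
    have := HasDerivAt.comp t (analyticAt_abelX hP (hI t)).differentiableAt.hasDerivAt (hy t)
    refine this.congr_deriv ?_
    simp only [hmdef, hvdef]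
    rw [← deriv_abelX_mul hP (hI t)]; ring
  have hx' : ∀ t, HasDerivAt (fun t => (u t).1) (-(v t * m t)) t := by
    intro t
    have := hx t
    rwa [← abelX_mul_abelSpeed hP (hI t)] at this
  have hmpos : ∀ t, 0 < m t := fun t => abelSpeed_pos hP (hvm t)
  have hmc : Continuous m := continuous_iff_continuousAt.2 fun t =>
    ContinuousAt.comp (analyticAt_abelSpeed hP (hvm t)).continuousAt (hv t).continuousAt
  set Φ : ℝ → ℝ := fun t => ∫ s in (0 : ℝ)..t, m s with hΦdef
  have hΦ : ∀ t, HasDerivAt Φ (m t) t := fun t => (hmc.integral_hasStrictDerivAt 0 t).hasDerivAt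
  have hΦ0 : Φ 0 = 0 := by simp [hΦdef]
  -- Turning (x, v) back by the accumulated angle `Φ` gives a constant vector; with `hB` this solves
  -- the system explicitly, with no appeal to uniqueness.
  have hA : ∀ t, (u t).1 * Real.cos (Φ t) + v t * Real.sin (Φ t) = (u 0).1 := by
    intro t
    have hd : ∀ t, HasDerivAt (fun t => (u t).1 * Real.cos (Φ t) + v t * Real.sin (Φ t)) 0 t := by
      intro t
      refine (((hx' t).fun_mul (hΦ t).cos).fun_add ((hv t).fun_mul (hΦ t).sin)).congr_deriv ?_
      ring
    have := is_const_of_deriv_eq_zero (fun t => (hd t).differentiableAt) (fun t => (hd t).deriv) t 0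
    simpa [hΦ0] using this
  have hB : ∀ t, v t * Real.cos (Φ t) - (u t).1 * Real.sin (Φ t) = v 0 := by
    intro t
    have hd : ∀ t, HasDerivAt (fun t => v t * Real.cos (Φ t) - (u t).1 * Real.sin (Φ t)) 0 t := by
      intro t
      refine (((hv t).fun_mul (hΦ t).cos).fun_sub ((hx' t).fun_mul (hΦ t).sin)).congr_deriv ?_
      ring
    have := is_const_of_deriv_eq_zero (fun t => (hd t).differentiableAt) (fun t => (hd t).deriv) t 0
    simpa [hΦ0] using this
  obtain ⟨r, θ₀, hr0, hx0, hv0, -⟩ := exists_polar_coordinates (u 0).1 (v 0)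
  set Θ : ℝ → ℝ := fun t => Φ t + θ₀ with hΘdef
  have hΘ : ∀ t, HasDerivAt Θ (m t) t := fun t => (hΦ t).add_const θ₀
  have hxc : ∀ t, (u t).1 = r * Real.cos (Θ t) := by
    intro t
    have h1 := hA t; have h2 := hB t
    have h3 := Real.sin_sq_add_cos_sq (Φ t)
    rw [hx0] at h1; rw [hv0] at h2
    simp only [hΘdef, Real.cos_add]
    linear_combination Real.cos (Φ t) * h1 - Real.sin (Φ t) * h2 - (u t).1 * h3
  have hvs : ∀ t, v t = r * Real.sin (Θ t) := by
    intro t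
    have h1 := hA t; have h2 := hB t
    have h3 := Real.sin_sq_add_cos_sq (Φ t)
    rw [hx0] at h1; rw [hv0] at h2
    simp only [hΘdef, Real.sin_add]
    linear_combination Real.sin (Φ t) * h1 + Real.cos (Φ t) * h2 - v t * h3
  have huΘ : ∀ t, u t = abelParam P r (Θ t) := by
    intro t
    refine Prod.ext (hxc t) ?_
    simp only [abelParam]
    rw [← hvs, hvdef]
    exact (abelY_abelX hP (hI t)).symm
  -- Radius zero would make `u` constant, and T/2 would be a smaller period.
  have hr : 0 < r := by
    refine lt_of_le_of_ne hr0 fun h => ?_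
    refine hmin (T / 2) (by linarith) (by linarith) fun t => ?_
    rw [huΘ, huΘ, ← h]
    simp [abelParam]
  have hmono : StrictMono Θ := strictMono_of_deriv_pos fun t => by
    rw [(hΘ t).deriv]; exact hmpos t
  have hcont : Continuous Θ := continuous_iff_continuousAt.2 fun t => (hΘ t).continuousAt
  -- The angle strictly increases and `u` returns to its start at time T, so it has advanced by a
  -- positive multiple of 2π. Thus every angle modulo 2π is attained inside the strip, which yields
  -- `H`.
  have hturn : Θ 0 + 2 * Real.pi ≤ Θ T := by
    have hT0 : u T = u 0 := by simpa using hper 0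
    have h1 : r * Real.cos (Θ 0) = r * Real.cos (Θ T) := by rw [← hxc, ← hxc, hT0]
    have h2 : r * Real.sin (Θ 0) = r * Real.sin (Θ T) := by rw [← hvs, ← hvs]; simp [hvdef, hT0]
    obtain ⟨n, hn⟩ := exists_eq_add_two_pi_of_cos_sin (mul_left_cancel₀ hr.ne' h1)
      (mul_left_cancel₀ hr.ne' h2)
    have h3 := hmono hT
    have h4 : 0 < (n : ℝ) := by
      refine pos_of_mul_pos_left (b := 2 * Real.pi) ?_ Real.two_pi_pos.le
      linarith
    have h5 : 0 < n := by exact_mod_cast h4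
    have h6 : (1 : ℝ) ≤ n := by exact_mod_cast h5
    rw [hn]
    nlinarith [Real.two_pi_pos]
  have H : ∀ θ, r * Real.sin θ ∈ abelRange P := by
    intro θ
    have hmem := toIcoMod_mem_Ico Real.two_pi_pos (Θ 0) θ
    obtain ⟨t, -, ht⟩ := intermediate_value_Icc hT.le hcont.continuousOn
      ⟨hmem.1, hmem.2.le.trans hturn⟩
    have hsin : Real.sin (toIcoMod Real.two_pi_pos (Θ 0) θ) = Real.sin θ := by
      rw [toIcoMod, zsmul_eq_mul, Real.sin_sub_int_mul_two_pi]
    rw [← hsin, ← ht, ← hvs]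
    exact hvm t
  have hτ : ∀ t, abelTime P r (Θ t) = t + abelTime P r (Θ 0) := by
    intro t
    have hd : ∀ t, HasDerivAt (fun t => abelTime P r (Θ t) - t) 0 t := by
      intro t
      have h1 := ((hasDerivAt_abelTime hP H (Θ t)).comp t (hΘ t)).sub (hasDerivAt_id t)
      have h2 := (hmpos t).ne'
      refine h1.congr_deriv ?_
      rw [← hvs, hmdef, inv_mul_cancel₀ h2, sub_self]
    have := is_const_of_deriv_eq_zero (fun t => (hd t).differentiableAt) (fun t => (hd t).deriv) t 0
    simp only [sub_zero] at this
    linarith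
  have hu' : u = fun t => abelParam P r (Θ t) := funext huΘ
  have hTr := abelPeriod_pos hP H
  have hiff := periodic_abelParam_comp_iff hP hr H hτ
  rw [← hu'] at hiff
  refine ⟨r, hr, H, by rw [hu']; exact range_abelParam_comp hP H hτ, ?_⟩
  obtain ⟨n, hn⟩ := (hiff T).1 hper
  have h1 : 0 < (n : ℝ) := pos_of_mul_pos_left (hn ▸ hT) hTr.le
  have h2 : (1 : ℝ) ≤ n := by exact_mod_cast (by exact_mod_cast h1 : 0 < n)
  refine le_antisymm ?_ (by nlinarith)
  by_contra! hlt
  exact hmin _ hTr hlt ((hiff _).2 ⟨1, by simp⟩)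

end Time

/-! ### Invariant lines, discs and interior regions. -/

section Geometry
variable {P : Polynomial ℝ} {r : ℝ}

/-- The intermediate value theorem gives a root between 0 and y. The last inequality encodes that,
seen from 0, y lies at or beyond y₀, whichever sign y₀ has. -/
theorem exists_root_of_notMem_abelStrip (hP : P.coeff 0 = 0) {y : ℝ} (hy : y ∉ abelStrip P) :
    ∃ y₀, y₀ ≠ 0 ∧ 1 + P.eval y₀ = 0 ∧ 0 ≤ y₀ * (y - y₀) := by
  have heval : P.eval 0 = 0 := by rw [← Polynomial.coeff_zero_eq_eval_zero, hP]
  have hy' : ¬ uIcc 0 y ⊆ {y | 0 < 1 + P.eval y} := hy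
  obtain ⟨s, hs, hs'⟩ := not_subset.1 hy'
  have hs'' : 1 + P.eval s ≤ 0 := not_lt.1 hs'
  have hcont : ContinuousOn (fun t => 1 + P.eval t) (uIcc 0 s) := by fun_prop
  obtain ⟨y₀, hy₀, h0⟩ := intermediate_value_uIcc hcont
    (show (0 : ℝ) ∈ uIcc (1 + P.eval 0) (1 + P.eval s) by
      rw [heval, uIcc_of_ge (by linarith)]; exact ⟨hs'', by norm_num⟩)
  have hne : y₀ ≠ 0 := by rintro rfl; simp [heval] at h0
  refine ⟨y₀, hne, h0, ?_⟩
  have hmem : y₀ ∈ uIcc 0 y := uIcc_subset_uIcc_left hs hy₀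
  rcases mem_uIcc.1 hmem with h | h
  · exact mul_nonneg h.1 (by linarith)
  · exact mul_nonneg_of_nonpos_of_nonpos h.2 (by linarith)

/-- Along a solution the sign of `y - y₀` is constant for each root `y₀` of `1 + P`. -/
theorem exists_sub_root_eq_mul_exp {u : ℝ → ℝ × ℝ} (hu : IsIntegralCurve u fun _ => abelField P)
    {y₀ : ℝ} (h0 : 1 + P.eval y₀ = 0) :
    ∃ E : ℝ → ℝ, ∀ t, (u t).2 - y₀ = ((u 0).2 - y₀) * Real.exp (E t) := by
  have hx : ∀ t, HasDerivAt (fun t => (u t).1) (-(u t).2) t := fun t => (hu t).fst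
  have hy : ∀ t, HasDerivAt (fun t => (u t).2) ((u t).1 * (1 + P.eval (u t).2)) t :=
    fun t => (hu t).snd
  -- With 1 + P = (y - y₀)Q the second equation is linear in y - y₀ with coefficient x Q(y); `E` is
  -- the integral of that coefficient.
  obtain ⟨Q, hQ⟩ := Polynomial.dvd_iff_isRoot.2 (show (1 + P).IsRoot y₀ by simpa using h0)
  have hQ' : ∀ y, 1 + P.eval y = (y - y₀) * Q.eval y := fun y => by
    simpa using congrArg (Polynomial.eval y) hQ
  have hcx : Continuous fun t => (u t).1 :=
    continuous_iff_continuousAt.2 fun t => (hx t).continuousAt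
  have hcy : Continuous fun t => (u t).2 :=
    continuous_iff_continuousAt.2 fun t => (hy t).continuousAt
  have hca : Continuous fun t => (u t).1 * Q.eval (u t).2 :=
    hcx.mul (Q.continuous.comp hcy)
  set E : ℝ → ℝ := fun t => ∫ s in (0 : ℝ)..t, (u s).1 * Q.eval (u s).2 with hE
  have hEd : ∀ t, HasDerivAt E ((u t).1 * Q.eval (u t).2) t := fun t =>
    (hca.integral_hasStrictDerivAt 0 t).hasDerivAt
  refine ⟨E, fun t => ?_⟩
  have hd : ∀ t, HasDerivAt (fun t => ((u t).2 - y₀) * Real.exp (-E t)) 0 t := by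
    intro t
    refine (((hy t).sub_const y₀).fun_mul (hEd t).fun_neg.exp).congr_deriv ?_
    rw [hQ']; ring
  have := is_const_of_deriv_eq_zero (fun t => (hd t).differentiableAt) (fun t => (hd t).deriv) t 0
  have hE0 : E 0 = 0 := by simp [hE]
  simp only [hE0, neg_zero, Real.exp_zero, mul_one] at this
  rw [← this, mul_assoc, ← Real.exp_add, neg_add_cancel, Real.exp_zero, mul_one]

/-- A cycle around the origin lies in the strip. -/
theorem IsCycleWithPeriod.mem_abelStrip (hP : P.coeff 0 = 0) {γ : Set (ℝ × ℝ)} {T : ℝ}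
    (hγ : IsCycleWithPeriod (abelField P) γ T) (h0 : ((0, 0) : ℝ × ℝ) ∈ interiorRegion γ)
    {q : ℝ × ℝ} (hq : q ∈ γ) : q.2 ∈ abelStrip P := by
  by_contra hy
  obtain ⟨u, hu, hT, hper, -, rfl⟩ := hγ
  obtain ⟨t₁, rfl⟩ := hq
  obtain ⟨y₀, hne, hroot, hle⟩ := exists_root_of_notMem_abelStrip hP hy
  obtain ⟨E, hE⟩ := exists_sub_root_eq_mul_exp hu hroot
  -- On the invariant line y = y₀ ≠ 0 one has x' = -y₀, so x drifts and cannot be periodic.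
  rcases eq_or_ne (u 0).2 y₀ with heq | hne'
  · have hconst : ∀ t, (u t).2 = y₀ := fun t => by
      have := hE t
      rw [heq, sub_self, zero_mul] at this
      linarith
    have hd : ∀ t, HasDerivAt (fun t => (u t).1 + y₀ * t) 0 t := by
      intro t
      have h1 : HasDerivAt (fun t => (u t).1) (-(u t).2) t := (hu t).fst
      refine (h1.fun_add ((hasDerivAt_id t).const_mul y₀)).congr_deriv ?_
      rw [hconst]; ring
    have := is_const_of_deriv_eq_zero (fun t => (hd t).differentiableAt) (fun t => (hd t).deriv) T 0
    have hT0 : u T = u 0 := by simpa using hper 0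
    rw [hT0] at this
    have h2 : y₀ * T = 0 := by linarith
    exact (mul_ne_zero hne hT.ne') h2
  · have hpos0 : 0 < y₀ * ((u 0).2 - y₀) := by
      rw [hE t₁, ← mul_assoc] at hle
      refine lt_of_le_of_ne (nonneg_of_mul_nonneg_left hle (Real.exp_pos _)) ?_
      exact (mul_ne_zero hne (sub_ne_zero.2 hne')).symm
    have hpos : ∀ t, 0 < y₀ * ((u t).2 - y₀) := fun t => by
      rw [hE t, ← mul_assoc]; exact mul_pos hpos0 (Real.exp_pos _)
    -- The orbit stays strictly beyond the line, so the open half-plane containing the origin misses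
    -- it. Being connected and unbounded, this half-plane contradicts the boundedness of the
    -- origin's component.
    set S : Set (ℝ × ℝ) := {q | y₀ * q.2 < y₀ * y₀} with hS
    have hconv : Convex ℝ S :=
      convex_halfSpace_lt ((y₀ • LinearMap.snd ℝ ℝ ℝ).isLinear) _
    have hsub : S ⊆ (range u)ᶜ := by
      rintro _ hq ⟨t, rfl⟩
      have h1 := hpos t
      have h2 : y₀ * (u t).2 < y₀ * y₀ := hq
      linarith
    have h0S : ((0, 0) : ℝ × ℝ) ∈ S := by
      simpa [hS] using mul_self_pos.2 hne
    have hbdd := h0.2.subset (hconv.isPreconnected.subset_connectedComponentIn h0S hsub)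
    obtain ⟨C, hC⟩ := hbdd.exists_norm_le
    have := hC (|C| + 1, 0) (by simpa [hS] using mul_self_pos.2 hne)
    have h3 : |C| + 1 ≤ ‖((|C| + 1, 0) : ℝ × ℝ)‖ := by
      refine le_trans ?_ (norm_fst_le _)
      exact le_abs_self _
    linarith [le_abs_self C]

theorem mem_abelCircle_iff (hP : P.coeff 0 = 0) (hr : 0 < r)
    (H : ∀ θ, r * Real.sin θ ∈ abelRange P) {q : ℝ × ℝ} :
    q ∈ abelCircle P r ↔ q.2 ∈ abelStrip P ∧ q.1 ^ 2 + abelX P q.2 ^ 2 = r ^ 2 := by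
  constructor
  · rintro ⟨θ, rfl⟩
    refine ⟨abelY_mem (H θ), ?_⟩
    simp only [abelParam]
    rw [abelX_abelY (H θ)]
    linear_combination r ^ 2 * Real.sin_sq_add_cos_sq θ
  · rintro ⟨h1, h2⟩
    obtain ⟨r', θ, hr', hx, hy, hsq⟩ := exists_polar_coordinates q.1 (abelX P q.2)
    have : r' = r := (sq_eq_sq₀ hr' hr.le).1 (by rw [← hsq, h2])
    subst this
    refine ⟨θ, Prod.ext hx.symm ?_⟩
    simp only [abelParam]
    rw [← hy, abelY_abelX hP h1]

theorem isOpen_abelDisc (hP : P.coeff 0 = 0) : IsOpen (abelDisc P r) := by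
  have h : ContinuousOn (fun q : ℝ × ℝ => q.1 ^ 2 + abelX P q.2 ^ 2) (Prod.snd ⁻¹' abelStrip P) :=
    (continuous_fst.pow 2).continuousOn.add
      (((continuousOn_abelX hP).comp continuous_snd.continuousOn fun _ h => h).pow 2)
  exact h.isOpen_inter_preimage (isOpen_abelStrip.preimage continuous_snd) (isOpen_Iio (a := r ^ 2))

theorem continuousOn_map_abelY (hP : P.coeff 0 = 0) {s : Set (ℝ × ℝ)}
    (hs : ∀ q ∈ s, q.2 ∈ abelRange P) :
    ContinuousOn (fun q : ℝ × ℝ => (q.1, abelY P q.2)) s :=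
  continuous_fst.continuousOn.prodMk ((continuousOn_abelY hP).comp continuous_snd.continuousOn hs)

theorem abs_le_of_add_sq_le (hr : 0 < r) {q : ℝ × ℝ} (hq : q.1 ^ 2 + q.2 ^ 2 ≤ r ^ 2) :
    |q.1| ≤ r ∧ |q.2| ≤ r :=
  ⟨abs_le_of_sq_le_sq (by nlinarith [sq_nonneg q.2]) hr.le,
    abs_le_of_sq_le_sq (by nlinarith [sq_nonneg q.1]) hr.le⟩

theorem isCompact_abelDisc_union_abelCircle (hP : P.coeff 0 = 0) (hr : 0 < r)
    (H : ∀ θ, r * Real.sin θ ∈ abelRange P) : IsCompact (abelDisc P r ∪ abelCircle P r) := by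
  set D : Set (ℝ × ℝ) := {q | q.1 ^ 2 + q.2 ^ 2 ≤ r ^ 2} with hD
  have hDc : IsCompact D := by
    refine (isCompact_Icc (a := ((-r, -r) : ℝ × ℝ)) (b := (r, r))).of_isClosed_subset
      (isClosed_le (by fun_prop) continuous_const) fun q hq => ?_
    have h := abs_le_of_add_sq_le hr hq
    exact ⟨⟨(abs_le.1 h.1).1, (abs_le.1 h.2).1⟩, ⟨(abs_le.1 h.1).2, (abs_le.1 h.2).2⟩⟩
  have hmem : ∀ q ∈ D, q.2 ∈ abelRange P := fun q hq =>
    mem_abelRange_of_abs_le hr H (abs_le_of_add_sq_le hr hq).2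
  have := hDc.image_of_continuousOn (continuousOn_map_abelY hP hmem)
  convert this using 1
  ext q
  rw [mem_union, mem_abelCircle_iff hP hr H]
  constructor
  · intro h
    have h1 : q.2 ∈ abelStrip P := h.elim (fun h => h.1) fun h => h.1
    have h2 : q.1 ^ 2 + abelX P q.2 ^ 2 ≤ r ^ 2 := h.elim (fun h => h.2.le) fun h => h.2.le
    exact ⟨(q.1, abelX P q.2), h2, by simp [abelY_abelX hP h1]⟩
  · rintro ⟨p, hp, rfl⟩
    have h1 := hmem p hp
    have h2 : p.1 ^ 2 + abelX P (abelY P p.2) ^ 2 ≤ r ^ 2 := by rw [abelX_abelY h1]; exact hp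
    rcases h2.lt_or_eq with h | h
    · exact Or.inl ⟨abelY_mem h1, h⟩
    · exact Or.inr ⟨abelY_mem h1, h⟩

/-- The complement of the circle is the union of two disjoint open sets, the disc and the complement
of the compact disc-plus-circle. A component meeting the disc therefore stays in it, so the Jordan
curve theorem is not needed. -/
theorem abelDisc_subset_interiorRegion (hP : P.coeff 0 = 0) (hr : 0 < r)
    (H : ∀ θ, r * Real.sin θ ∈ abelRange P) :
    abelDisc P r ⊆ interiorRegion (abelCircle P r) := by
  have hK := isCompact_abelDisc_union_abelCircle hP hr H
  have hdisj : Disjoint (abelDisc P r) (abelCircle P r) := by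
    rw [disjoint_left]
    intro q h1 h2
    exact h1.2.ne ((mem_abelCircle_iff hP hr H).1 h2).2
  intro q hq
  have hqc : q ∈ (abelCircle P r)ᶜ := disjoint_left.1 hdisj hq
  refine ⟨hqc, hK.isBounded.subset (Subset.trans ?_ subset_union_left)⟩
  refine IsPreconnected.subset_left_of_subset_union (isOpen_abelDisc hP) hK.isClosed.isOpen_compl
    (disjoint_compl_right.mono_left subset_union_left) ?_ ⟨q, mem_connectedComponentIn hqc, hq⟩
    isPreconnected_connectedComponentIn
  intro p hp
  have hp' : p ∉ abelCircle P r := connectedComponentIn_subset _ _ hp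
  by_cases h : p ∈ abelDisc P r
  · exact Or.inl h
  · exact Or.inr fun h' => h'.elim h hp'

theorem isPreconnected_abelDisc (hP : P.coeff 0 = 0) (hr : 0 < r)
    (H : ∀ θ, r * Real.sin θ ∈ abelRange P) : IsPreconnected (abelDisc P r) := by
  set D : Set (ℝ × ℝ) := {q | q.1 ^ 2 + q.2 ^ 2 < r ^ 2} with hD
  have hconv : Convex ℝ D := by
    intro p hp q hq a b ha hb hab
    have hp' : p.1 ^ 2 + p.2 ^ 2 < r ^ 2 := hp
    have hq' : q.1 ^ 2 + q.2 ^ 2 < r ^ 2 := hq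
    obtain rfl : b = 1 - a := by linarith
    have h1 : (a * p.1 + (1 - a) * q.1) ^ 2 + (a * p.2 + (1 - a) * q.2) ^ 2
        = a * (p.1 ^ 2 + p.2 ^ 2) + (1 - a) * (q.1 ^ 2 + q.2 ^ 2)
          - a * (1 - a) * ((p.1 - q.1) ^ 2 + (p.2 - q.2) ^ 2) := by ring
    have h2 : 0 ≤ a * (1 - a) * ((p.1 - q.1) ^ 2 + (p.2 - q.2) ^ 2) := by positivity
    have h3 : a * (p.1 ^ 2 + p.2 ^ 2) + (1 - a) * (q.1 ^ 2 + q.2 ^ 2) < r ^ 2 := by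
      rcases ha.eq_or_lt with rfl | ha'
      · linarith
      · nlinarith
    change (a * p.1 + (1 - a) * q.1) ^ 2 + (a * p.2 + (1 - a) * q.2) ^ 2 < r ^ 2
    linarith
  have hmem : ∀ q ∈ D, q.2 ∈ abelRange P := fun q hq =>
    mem_abelRange_of_abs_le hr H (abs_le_of_add_sq_le hr (le_of_lt hq)).2
  have := hconv.isPreconnected.image _ (continuousOn_map_abelY hP hmem)
  convert this using 1
  ext q
  constructor
  · rintro ⟨h1, h2⟩
    exact ⟨(q.1, abelX P q.2), h2, by simp [abelY_abelX hP h1]⟩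
  · rintro ⟨p, hp, rfl⟩
    have h1 := hmem p hp
    refine ⟨abelY_mem h1, ?_⟩
    simp only
    rw [abelX_abelY h1]; exact hp

theorem zero_mem_abelDisc (hP : P.coeff 0 = 0) (hr : 0 < r) :
    ((0, 0) : ℝ × ℝ) ∈ abelDisc P r :=
  ⟨zero_mem_abelStrip hP, by simpa [abelX_zero] using pow_pos hr 2⟩

/-- The level curves near the origin are admissible. -/
theorem exists_admissible_radius (hP : P.coeff 0 = 0) :
    ∃ R, 0 < R ∧ ∀ r, 0 < r → r < R → ∀ θ, r * Real.sin θ ∈ abelRange P := by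
  obtain ⟨R, hR, hball⟩ := Metric.isOpen_iff.1 (isOpen_abelRange hP) 0 (zero_mem_abelRange hP)
  refine ⟨R, hR, fun r hr hrR θ => hball ?_⟩
  rw [Metric.mem_ball, dist_zero_right, Real.norm_eq_abs, abs_mul, abs_of_pos hr]
  have := Real.abs_sin_le_one θ
  nlinarith

theorem exists_mem_abelCircle (hP : P.coeff 0 = 0) {q : ℝ × ℝ} (hq : q.2 ∈ abelStrip P)
    (h0 : q ≠ (0, 0)) : ∃ r, 0 < r ∧ q ∈ abelCircle P r ∧ q.1 ^ 2 + abelX P q.2 ^ 2 = r ^ 2 := by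
  obtain ⟨r, θ, hr, hx, hy, hsq⟩ := exists_polar_coordinates q.1 (abelX P q.2)
  refine ⟨r, lt_of_le_of_ne hr fun h => h0 ?_, ⟨θ, Prod.ext hx.symm ?_⟩, hsq⟩
  · subst h
    rw [zero_mul] at hx hy
    refine Prod.ext hx ?_
    by_contra hne
    exact abelX_ne_zero hP hq hne hy
  · simp only [abelParam]
    rw [← hy, abelY_abelX hP hq]

theorem mem_onCycleSurrounding (hP : P.coeff 0 = 0) (hr : 0 < r)
    (H : ∀ θ, r * Real.sin θ ∈ abelRange P) {q : ℝ × ℝ} (hq : q ∈ abelCircle P r) :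
    q ∈ onCycleSurrounding (abelField P) (0, 0) :=
  ⟨_, _, isCycleWithPeriod_abelCircle hP hr H,
    abelDisc_subset_interiorRegion hP hr H (zero_mem_abelDisc hP hr), hq⟩

theorem isCenter_abelField (hP : P.coeff 0 = 0) : IsCenter (abelField P) (0, 0) := by
  have heval : P.eval 0 = 0 := by rw [← Polynomial.coeff_zero_eq_eval_zero, hP]
  refine ⟨by simp [abelField], ?_, ?_⟩
  · filter_upwards [self_mem_nhdsWithin] with q hq h
    simp only [abelField, Prod.mk_eq_zero] at h
    have h2 : q.2 = 0 := by linarith [h.1]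
    rw [h2, heval] at h
    exact hq (Prod.ext (by linarith [h.2]) h2)
  · obtain ⟨R, hR, H⟩ := exists_admissible_radius hP
    filter_upwards [nhdsWithin_le_nhds ((isOpen_abelDisc hP).mem_nhds (zero_mem_abelDisc hP hR)),
      self_mem_nhdsWithin] with q hq hq0
    obtain ⟨r, hr, hmem, hsq⟩ := exists_mem_abelCircle hP hq.1 hq0
    have hrR : r < R := lt_of_pow_lt_pow_left₀ 2 hR.le (hsq ▸ hq.2)
    exact mem_onCycleSurrounding hP hr (H r hr hrR) hmem

theorem snd_mem_abelStrip_of_mem_periodAnnulus (hP : P.coeff 0 = 0) {q : ℝ × ℝ}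
    (hq : q ∈ periodAnnulus (abelField P) (0, 0)) : q.2 ∈ abelStrip P := by
  rcases connectedComponentIn_subset _ _ hq.1 with h | ⟨γ, T, hγ, h0, hqγ⟩
  · exact absurd h hq.2
  · exact hγ.mem_abelStrip hP h0 hqγ

/-- Small level curves lie in the period annulus. -/
theorem exists_abelCircle_subset_periodAnnulus (hP : P.coeff 0 = 0) :
    ∃ R, 0 < R ∧ ∀ r, 0 < r → r < R → (∀ θ, r * Real.sin θ ∈ abelRange P) ∧
      abelCircle P r ⊆ periodAnnulus (abelField P) (0, 0) := by
  obtain ⟨R, hR, H⟩ := exists_admissible_radius hP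
  -- Halving makes the bounding radius itself admissible, as connectedness of its disc requires.
  refine ⟨R / 2, by linarith, fun r hr hrR => ⟨H r hr (by linarith), ?_⟩⟩
  have hR2 : (0 : ℝ) < R / 2 := by linarith
  have hpre := isPreconnected_abelDisc hP hR2 (H (R / 2) hR2 (by linarith))
  have hsub : abelDisc P (R / 2) ⊆
      insert (0, 0) (onCycleSurrounding (abelField P) (0, 0)) := by
    intro q hq
    by_cases hq0 : q = (0, 0)
    · exact Or.inl hq0
    obtain ⟨s, hs, hmem, hsq⟩ := exists_mem_abelCircle hP hq.1 hq0
    have hsR : s < R / 2 := lt_of_pow_lt_pow_left₀ 2 hR2.le (hsq ▸ hq.2)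
    exact Or.inr (mem_onCycleSurrounding hP hs (H s hs (by linarith)) hmem)
  intro q hq
  have hq' := (mem_abelCircle_iff hP hr (H r hr (by linarith))).1 hq
  refine ⟨hpre.subset_connectedComponentIn (zero_mem_abelDisc hP hR2) hsub
    ⟨hq'.1, by rw [hq'.2]; exact pow_lt_pow_left₀ hrR hr.le two_ne_zero⟩, ?_⟩
  rintro rfl
  have := hq'.2
  simp [abelX_zero] at this
  exact (pow_pos hr 2).ne this

/-- If r₂ < r₁, a point of the second circle lies in the first disc, hence in the first interior and
so in the second, which avoids its own circle. -/
theorem radius_lt_of_interiorRegion_ssubset (hP : P.coeff 0 = 0) {r₁ r₂ : ℝ} (hr₁ : 0 < r₁)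
    (hr₂ : 0 < r₂) (H₁ : ∀ θ, r₁ * Real.sin θ ∈ abelRange P)
    (H₂ : ∀ θ, r₂ * Real.sin θ ∈ abelRange P)
    (h : interiorRegion (abelCircle P r₁) ⊂ interiorRegion (abelCircle P r₂)) : r₁ < r₂ := by
  by_contra! hle
  rcases hle.eq_or_lt with rfl | hlt
  · exact h.ne rfl
  · have hq : abelParam P r₂ 0 ∈ abelCircle P r₂ := mem_range_self 0
    have hq' := (mem_abelCircle_iff hP hr₂ H₂).1 hq
    have hD : abelParam P r₂ 0 ∈ abelDisc P r₁ :=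
      ⟨hq'.1, by rw [hq'.2]; exact pow_lt_pow_left₀ hlt hr₂.le two_ne_zero⟩
    exact (h.subset (abelDisc_subset_interiorRegion hP hr₁ H₁ hD)).1 hq

end Geometry

/-! ### Monotonicity of the period through E. -/

/-- Twice the even part of the reciprocal of the angular speed. -/
def abelEven (P : Polynomial ℝ) (v : ℝ) : ℝ := (abelSpeed P v)⁻¹ + (abelSpeed P (-v))⁻¹

section Period
variable {P : Polynomial ℝ} {r : ℝ}

theorem analyticAt_abelEven (hP : P.coeff 0 = 0) {v : ℝ} (h1 : v ∈ abelRange P)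
    (h2 : -v ∈ abelRange P) : AnalyticAt ℝ (abelEven P) v :=
  ((analyticAt_abelSpeed hP h1).fun_inv (abelSpeed_pos hP h1).ne').fun_add
    ((AnalyticAt.fun_comp (analyticAt_abelSpeed hP h2) analyticAt_id.fun_neg).fun_inv
      (abelSpeed_pos hP h2).ne')

theorem analyticAt_abelEven_zero (hP : P.coeff 0 = 0) : AnalyticAt ℝ (abelEven P) 0 :=
  analyticAt_abelEven hP (zero_mem_abelRange hP) (by simpa using zero_mem_abelRange hP)

theorem abelEven_zero (hP : P.coeff 0 = 0) : abelEven P 0 = 2 := by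
  simp [abelEven, abelSpeed_zero hP]; norm_num

theorem neg_mul_sin_mem (H : ∀ θ, r * Real.sin θ ∈ abelRange P) (θ : ℝ) :
    -(r * Real.sin θ) ∈ abelRange P := by
  have := H (θ + Real.pi)
  rwa [Real.sin_add_pi, mul_neg] at this

/-- The half-turn [π, 2π] is folded onto [0, π] by sin(s + π) = -sin s, so only the even part of 1/m
matters. -/
theorem abelPeriod_eq_integral_abelEven (hP : P.coeff 0 = 0)
    (H : ∀ θ, r * Real.sin θ ∈ abelRange P) :
    abelPeriod P r = ∫ s in (0 : ℝ)..Real.pi, abelEven P (r * Real.sin s) := by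
  have hc := continuous_abelSpeed_inv hP H
  have h1 := intervalIntegral.integral_comp_add_right (a := 0) (b := Real.pi)
    (fun s => (abelSpeed P (r * Real.sin s))⁻¹) Real.pi
  have hc' : Continuous fun s => (abelSpeed P (r * Real.sin (s + Real.pi)))⁻¹ :=
    hc.comp (continuous_add_const Real.pi)
  rw [zero_add, ← two_mul] at h1
  rw [abelPeriod, abelTime, ← intervalIntegral.integral_add_adjacent_intervals
    (hc.intervalIntegrable 0 Real.pi) (hc.intervalIntegrable Real.pi (2 * Real.pi)), ← h1,
    ← intervalIntegral.integral_add (hc.intervalIntegrable _ _) (hc'.intervalIntegrable _ _)]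
  simp [abelEven, Real.sin_add_pi]

theorem continuous_abelEven_mul_sin (hP : P.coeff 0 = 0)
    (H : ∀ θ, r * Real.sin θ ∈ abelRange P) : Continuous fun s => abelEven P (r * Real.sin s) :=
  continuous_iff_continuousAt.2 fun s => ContinuousAt.comp (f := fun s => r * Real.sin s)
    (analyticAt_abelEven hP (H s) (neg_mul_sin_mem H s)).continuousAt (by fun_prop)

theorem abelPeriod_lt_of_lt (hP : P.coeff 0 = 0) {r₁ r₂ : ℝ}
    (H₁ : ∀ θ, r₁ * Real.sin θ ∈ abelRange P) (H₂ : ∀ θ, r₂ * Real.sin θ ∈ abelRange P)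
    (h : ∀ s, 0 < s → s ≤ 1 → abelEven P (r₁ * s) < abelEven P (r₂ * s)) :
    abelPeriod P r₁ < abelPeriod P r₂ := by
  rw [abelPeriod_eq_integral_abelEven hP H₁, abelPeriod_eq_integral_abelEven hP H₂]
  refine intervalIntegral.integral_lt_integral_of_continuousOn_of_le_of_exists_lt Real.pi_pos
    (continuous_abelEven_mul_sin hP H₁).continuousOn
    (continuous_abelEven_mul_sin hP H₂).continuousOn ?_
    -- At s = π both integrands equal E(0), so strictness is taken at π/2.
    ⟨Real.pi / 2, ⟨by linarith [Real.pi_pos], by linarith [Real.pi_pos]⟩, ?_⟩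
  · intro s hs
    rcases hs.2.eq_or_lt with rfl | hlt
    · simp
    · exact (h _ (Real.sin_pos_of_pos_of_lt_pi hs.1 hlt) (Real.sin_le_one s)).le
  · exact h _ (by simp) (by simp)

theorem exists_ball_subset_abelRange (hP : P.coeff 0 = 0) :
    ∃ R, 0 < R ∧ (∀ v, |v| < R → v ∈ abelRange P) := by
  obtain ⟨R, hR, hball⟩ := Metric.isOpen_iff.1 (isOpen_abelRange hP) 0 (zero_mem_abelRange hP)
  exact ⟨R, hR, fun v hv => hball (by simpa using hv)⟩

theorem mul_sin_mem_of_lt {R : ℝ} (hR : ∀ v, |v| < R → v ∈ abelRange P) (hr : 0 < r) (hrR : r < R)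
    (θ : ℝ) : r * Real.sin θ ∈ abelRange P := by
  refine hR _ ?_
  rw [abs_mul, abs_of_pos hr]
  have := Real.abs_sin_le_one θ
  nlinarith

theorem continuousOn_abelEven (hP : P.coeff 0 = 0) {R : ℝ}
    (hR : ∀ v, |v| < R → v ∈ abelRange P) : ContinuousOn (abelEven P) (Ico 0 R) := fun v hv =>
  (analyticAt_abelEven hP (hR v (by rw [abs_of_nonneg hv.1]; exact hv.2))
    (hR (-v) (by rw [abs_neg, abs_of_nonneg hv.1]; exact hv.2))).continuousAt.continuousWithinAt

theorem strictMonoOn_abelPeriod (hP : P.coeff 0 = 0) {R : ℝ}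
    (hR : ∀ v, |v| < R → v ∈ abelRange P) (hd : ∀ v ∈ Ioo 0 R, 0 < deriv (abelEven P) v) :
    StrictMonoOn (abelPeriod P) (Ioo 0 R) := by
  have hmono : StrictMonoOn (abelEven P) (Ico 0 R) :=
    strictMonoOn_of_deriv_pos (convex_Ico 0 R) (continuousOn_abelEven hP hR)
      (by rw [interior_Ico]; exact hd)
  intro r₁ h₁ r₂ h₂ hlt
  refine abelPeriod_lt_of_lt hP (mul_sin_mem_of_lt hR h₁.1 h₁.2) (mul_sin_mem_of_lt hR h₂.1 h₂.2)
    fun s hs0 hs1 => hmono ⟨by have := h₁.1; positivity, ?_⟩ ⟨by have := h₂.1; positivity, ?_⟩ ?_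
  · nlinarith [h₁.1, h₁.2]
  · nlinarith [h₂.1, h₂.2]
  · exact mul_lt_mul_of_pos_right hlt hs0

theorem strictAntiOn_abelPeriod (hP : P.coeff 0 = 0) {R : ℝ}
    (hR : ∀ v, |v| < R → v ∈ abelRange P) (hd : ∀ v ∈ Ioo 0 R, deriv (abelEven P) v < 0) :
    StrictAntiOn (abelPeriod P) (Ioo 0 R) := by
  have hmono : StrictAntiOn (abelEven P) (Ico 0 R) :=
    strictAntiOn_of_deriv_neg (convex_Ico 0 R) (continuousOn_abelEven hP hR)
      (by rw [interior_Ico]; exact hd)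
  intro r₁ h₁ r₂ h₂ hlt
  refine abelPeriod_lt_of_lt hP (mul_sin_mem_of_lt hR h₂.1 h₂.2) (mul_sin_mem_of_lt hR h₁.1 h₁.2)
    fun s hs0 hs1 => hmono ⟨by have := h₁.1; positivity, ?_⟩ ⟨by have := h₂.1; positivity, ?_⟩ ?_
  · nlinarith [h₁.1, h₁.2]
  · nlinarith [h₂.1, h₂.2]
  · exact mul_lt_mul_of_pos_right hlt hs0

theorem exists_radius_of_cycles (hP : P.coeff 0 = 0) {R : ℝ} (hR : 0 < R)
    {γ : Set (ℝ × ℝ)} {T : ℝ} (hγ : IsCycleWithPeriod (abelField P) γ T)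
    (h0 : ((0, 0) : ℝ × ℝ) ∈ interiorRegion γ) (hV : γ ⊆ abelDisc P R) :
    ∃ r ∈ Ioo 0 R, (∀ θ, r * Real.sin θ ∈ abelRange P) ∧ γ = abelCircle P r ∧
      T = abelPeriod P r := by
  obtain ⟨r, hr, H, rfl, rfl⟩ := hγ.eq_abelCircle hP fun q hq => hγ.mem_abelStrip hP h0 hq
  refine ⟨r, ⟨hr, ?_⟩, H, rfl, rfl⟩
  have hq : abelParam P r 0 ∈ abelCircle P r := mem_range_self 0
  have h1 := ((mem_abelCircle_iff hP hr H).1 hq).2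
  exact lt_of_pow_lt_pow_left₀ 2 hR.le (h1 ▸ (hV hq).2)

theorem periodIncreasesNear_of_strictMonoOn (hP : P.coeff 0 = 0) {R : ℝ} (hR : 0 < R)
    (h : StrictMonoOn (abelPeriod P) (Ioo 0 R)) : PeriodIncreasesNear (abelField P) (0, 0) := by
  refine ⟨abelDisc P R, (isOpen_abelDisc hP).mem_nhds (zero_mem_abelDisc hP hR), ?_⟩
  intro γ₁ T₁ γ₂ T₂ hγ₁ hγ₂ hV₁ hV₂ h₁ h₂ hss
  obtain ⟨r₁, hr₁, H₁, rfl, rfl⟩ := exists_radius_of_cycles hP hR hγ₁ h₁ hV₁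
  obtain ⟨r₂, hr₂, H₂, rfl, rfl⟩ := exists_radius_of_cycles hP hR hγ₂ h₂ hV₂
  exact h hr₁ hr₂ (radius_lt_of_interiorRegion_ssubset hP hr₁.1 hr₂.1 H₁ H₂ hss)

theorem periodDecreasesNear_of_strictAntiOn (hP : P.coeff 0 = 0) {R : ℝ} (hR : 0 < R)
    (h : StrictAntiOn (abelPeriod P) (Ioo 0 R)) : PeriodDecreasesNear (abelField P) (0, 0) := by
  refine ⟨abelDisc P R, (isOpen_abelDisc hP).mem_nhds (zero_mem_abelDisc hP hR), ?_⟩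
  intro γ₁ T₁ γ₂ T₂ hγ₁ hγ₂ hV₁ hV₂ h₁ h₂ hss
  obtain ⟨r₁, hr₁, H₁, rfl, rfl⟩ := exists_radius_of_cycles hP hR hγ₁ h₁ hV₁
  obtain ⟨r₂, hr₂, H₂, rfl, rfl⟩ := exists_radius_of_cycles hP hR hγ₂ h₂ hV₂
  exact h hr₁ hr₂ (radius_lt_of_interiorRegion_ssubset hP hr₁.1 hr₂.1 H₁ H₂ hss)

/-- The second order Taylor coefficients of the angular speed at the origin. -/
theorem abelSpeed_taylor (hP : P.coeff 0 = 0) :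
    3 * deriv (abelSpeed P) 0 = P.coeff 1 ∧
    4 * deriv (deriv (abelSpeed P)) 0 + 4 * deriv (abelSpeed P) 0 ^ 2 =
      2 * P.coeff 2 + 2 * P.coeff 1 * deriv (abelSpeed P) 0 := by
  set m := abelSpeed P with hm
  have hm0 : m 0 = 1 := abelSpeed_zero hP
  have han : AnalyticAt ℝ m 0 := analyticAt_abelSpeed hP (zero_mem_abelRange hP)
  have hc1 : (Polynomial.derivative P).eval 0 = P.coeff 1 := by
    rw [← Polynomial.coeff_zero_eq_eval_zero, Polynomial.coeff_derivative]; simp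
  have hc2 : (Polynomial.derivative (Polynomial.derivative P)).eval 0 = 2 * P.coeff 2 := by
    rw [← Polynomial.coeff_zero_eq_eval_zero, Polynomial.coeff_derivative,
      Polynomial.coeff_derivative]
    norm_num; ring
  have hd1 : ∀ᶠ v in 𝓝 (0 : ℝ), HasDerivAt m (deriv m v) v :=
    han.eventually_analyticAt.mono fun v h => h.differentiableAt.hasDerivAt
  have hd2 : ∀ᶠ v in 𝓝 (0 : ℝ), HasDerivAt (deriv m) (deriv (deriv m) v) v :=
    han.deriv.eventually_analyticAt.mono fun v h => h.differentiableAt.hasDerivAt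
  have hd3 : HasDerivAt (deriv (deriv m)) (deriv (deriv (deriv m)) 0) 0 :=
    han.deriv.deriv.differentiableAt.hasDerivAt
  have hY : abelY P = fun v => v * m v := funext fun v => (mul_abelSpeed hP v).symm
  -- This is Y' m = 1 + P(Y) with Y = v m. Differentiating once and twice at 0 gives the two
  -- coefficient relations.
  have hF : (fun v => (m v + v * deriv m v) * m v - (1 + P.eval (v * m v))) =ᶠ[𝓝 0] fun _ => 0 := by
    filter_upwards [hd1, (isOpen_abelRange hP).mem_nhds (zero_mem_abelRange hP)] with v h1 hv
    have h2 := deriv_abelY_mul hP hv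
    rw [hY, ((hasDerivAt_id' v).fun_mul h1).deriv, one_mul] at h2
    rw [← h2, sub_self]
  have hF1 : (fun v => (2 * deriv m v + v * deriv (deriv m) v) * m v
      + (m v + v * deriv m v) * deriv m v
      - (Polynomial.derivative P).eval (v * m v) * (m v + v * deriv m v)) =ᶠ[𝓝 0] fun _ => 0 := by
    filter_upwards [hF.eventuallyEq_nhds, hd1, hd2] with v h0 h1 h2
    have hY' := (hasDerivAt_id' v).fun_mul h1
    have h3 := (((h1.fun_add ((hasDerivAt_id' v).fun_mul h2)).fun_mul h1).fun_sub
      (((P.hasDerivAt (v * m v)).comp v hY').const_add 1)).congr_of_eventuallyEq h0.symm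
    have h4 := h3.unique (hasDerivAt_const v (0 : ℝ))
    rw [← h4]; ring
  have e1 := hF1.self_of_nhds
  have hm1 := hd1.self_of_nhds
  have hm2 := hd2.self_of_nhds
  have hY' := (hasDerivAt_id' (0 : ℝ)).fun_mul hm1
  have h3 := (((((hm2.const_mul 2).fun_add ((hasDerivAt_id' (0 : ℝ)).fun_mul hd3)).fun_mul hm1).fun_add
      ((hm1.fun_add ((hasDerivAt_id' (0 : ℝ)).fun_mul hm2)).fun_mul hm2)).fun_sub
      ((((Polynomial.derivative P).hasDerivAt (0 * m 0)).comp (0 : ℝ) hY').fun_mul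
        (hm1.fun_add ((hasDerivAt_id' (0 : ℝ)).fun_mul hm2)))).congr_of_eventuallyEq hF1.symm
  have e2 := h3.unique (hasDerivAt_const (0 : ℝ) (0 : ℝ))
  simp only [Function.comp, zero_mul, hm0, hc1, hc2] at e1 e2
  constructor
  · linear_combination e1
  · linear_combination e2

/-- E is even, so E'(0) = 0, and E''(0) = 2(2m'(0)² - m''(0)), where m'(0) = a₁/3 and m''(0) = a₂/2
+ a₁²/18. -/
theorem hasDerivAt_deriv_abelEven (hP : P.coeff 0 = 0) :
    deriv (abelEven P) 0 = 0 ∧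
    HasDerivAt (deriv (abelEven P)) ((P.coeff 1 ^ 2 - 3 * P.coeff 2) / 3) 0 := by
  obtain ⟨t1, t2⟩ := abelSpeed_taylor hP
  set m := abelSpeed P with hm
  have hm0 : m 0 = 1 := abelSpeed_zero hP
  have han : AnalyticAt ℝ m 0 := analyticAt_abelSpeed hP (zero_mem_abelRange hP)
  have hneg : Tendsto (fun v : ℝ => -v) (𝓝 0) (𝓝 0) := by
    simpa using (continuous_neg (G := ℝ)).tendsto 0
  have hd1 : ∀ᶠ v in 𝓝 (0 : ℝ), HasDerivAt m (deriv m v) v ∧ m v ≠ 0 := by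
    filter_upwards [han.eventually_analyticAt, han.continuousAt.eventually_ne (hm0 ▸ one_ne_zero)]
      with v h h' using ⟨h.differentiableAt.hasDerivAt, h'⟩
  have hm2 : HasDerivAt (deriv m) (deriv (deriv m) 0) 0 :=
    han.deriv.differentiableAt.hasDerivAt
  have hK : deriv (abelEven P) =ᶠ[𝓝 0]
      fun v => -deriv m v / m v ^ 2 + deriv m (-v) / m (-v) ^ 2 := by
    filter_upwards [hd1, hneg.eventually hd1] with v h1 h2
    have h3 := HasDerivAt.comp v h2.1 (hasDerivAt_neg' v)
    have h4 := (h1.1.fun_inv h1.2).fun_add (h3.fun_inv h2.2)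
    refine h4.deriv.trans ?_
    simp only [Function.comp]
    ring
  have hm1 := hd1.self_of_nhds.1
  have hn : ∀ {f : ℝ → ℝ} {c : ℝ}, HasDerivAt f c 0 → HasDerivAt (fun v => f (-v)) (-c) 0 := by
    intro f c hf
    have h : HasDerivAt f c (-0) := by rwa [neg_zero]
    exact (HasDerivAt.comp (0 : ℝ) h (hasDerivAt_neg' (0 : ℝ))).congr_deriv (by ring)
  constructor
  · rw [hK.self_of_nhds]; simp [hm0]
  · have h1 := (hm2.fun_neg.fun_div (hm1.fun_pow 2) (by simp [hm0])).fun_add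
      ((hn hm2).fun_div ((hn hm1).fun_pow 2) (by simp [hm0]))
    refine (h1.congr_of_eventuallyEq hK).congr_deriv ?_
    simp only [neg_zero, hm0]
    norm_num
    linear_combination (-1 / 2) * t2 + (2 * deriv m 0 + 1 / 3 * P.coeff 1) * t1

/-- As E'(0) = 0, the slope E'(v)/v tends to E''(0) > 0. -/
theorem exists_pos_and_forall_deriv_abelEven_pos (hP : P.coeff 0 = 0)
    (h : 0 < P.coeff 1 ^ 2 - 3 * P.coeff 2) :
    ∃ R, 0 < R ∧ (∀ v, |v| < R → v ∈ abelRange P) ∧ ∀ v ∈ Ioo 0 R, 0 < deriv (abelEven P) v := by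
  obtain ⟨h0, hd⟩ := hasDerivAt_deriv_abelEven hP
  obtain ⟨R₁, hR₁, hsub⟩ := exists_ball_subset_abelRange hP
  have h1 := (hasDerivAt_iff_tendsto_slope.1 hd).eventually_const_lt (show (0 : ℝ) < _ / 3 by linarith)
  rw [eventually_nhdsWithin_iff] at h1
  obtain ⟨R₂, hR₂, hball⟩ := Metric.eventually_nhds_iff_ball.1 h1
  refine ⟨min R₁ R₂, lt_min hR₁ hR₂, fun v hv => hsub v (hv.trans_le (min_le_left _ _)), ?_⟩
  intro v hv
  have h2 := hball v (by
    rw [Metric.mem_ball, dist_zero_right, Real.norm_eq_abs, abs_of_pos hv.1]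
    exact hv.2.trans_le (min_le_right _ _)) hv.1.ne'
  rw [slope_def_field, h0, sub_zero, sub_zero] at h2
  exact (div_pos_iff_of_pos_right hv.1).1 h2

theorem exists_pos_and_forall_deriv_abelEven_neg (hP : P.coeff 0 = 0)
    (h : P.coeff 1 ^ 2 - 3 * P.coeff 2 < 0) :
    ∃ R, 0 < R ∧ (∀ v, |v| < R → v ∈ abelRange P) ∧ ∀ v ∈ Ioo 0 R, deriv (abelEven P) v < 0 := by
  obtain ⟨h0, hd⟩ := hasDerivAt_deriv_abelEven hP
  obtain ⟨R₁, hR₁, hsub⟩ := exists_ball_subset_abelRange hP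
  have h1 := (hasDerivAt_iff_tendsto_slope.1 hd).eventually_lt_const (show _ / 3 < (0 : ℝ) by linarith)
  rw [eventually_nhdsWithin_iff] at h1
  obtain ⟨R₂, hR₂, hball⟩ := Metric.eventually_nhds_iff_ball.1 h1
  refine ⟨min R₁ R₂, lt_min hR₁ hR₂, fun v hv => hsub v (hv.trans_le (min_le_left _ _)), ?_⟩
  intro v hv
  have h2 := hball v (by
    rw [Metric.mem_ball, dist_zero_right, Real.norm_eq_abs, abs_of_pos hv.1]
    exact hv.2.trans_le (min_le_right _ _)) hv.1.ne'
  rw [slope_def_field, h0, sub_zero, sub_zero] at h2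
  exact (div_neg_iff.1 h2).resolve_left (fun h => absurd h.2 hv.1.not_gt) |>.1

end Period

/-! ### Isochronicity, Urabe functions and even P. -/

section Isochronous
variable {P : Polynomial ℝ}

theorem eventually_abelEven_eq_two_of_isIsochronousCenter (hP : P.coeff 0 = 0)
    (h : IsIsochronousCenter (abelField P) (0, 0)) : ∀ᶠ v in 𝓝 0, abelEven P v = 2 := by
  obtain ⟨-, T₀, hT₀⟩ := h
  obtain ⟨R₁, hR₁, hann⟩ := exists_abelCircle_subset_periodAnnulus hP
  obtain ⟨R₂, hR₂, hsub⟩ := exists_ball_subset_abelRange hP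
  have hper : ∀ r, 0 < r → r < R₁ → abelPeriod P r = T₀ := fun r h0 h1 =>
    hT₀ _ _ (isCycleWithPeriod_abelCircle hP h0 (hann r h0 h1).1) (hann r h0 h1).2
  have han := analyticAt_abelEven_zero hP
  have hdiff := han.eventually_analyticAt
  -- By analyticity, E' either vanishes near 0, so E = E(0) = 2, or has no zeros on some (0, R). In
  -- the second case the Darboux property fixes its sign and the period is strictly monotone,
  -- contradicting equal periods at R/3 and R/2.
  rcases han.deriv.eventually_eq_zero_or_eventually_ne_zero with h0 | hne
  · obtain ⟨ε, hε, hball⟩ := Metric.eventually_nhds_iff_ball.1 (hdiff.and h0)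
    filter_upwards [Metric.ball_mem_nhds 0 hε] with v hv
    rw [← abelEven_zero hP]
    exact Metric.isOpen_ball.is_const_of_deriv_eq_zero (convex_ball (0 : ℝ) ε).isPreconnected
      (fun y hy => (hball y hy).1.differentiableAt.differentiableWithinAt)
      (fun y hy => (hball y hy).2) hv (Metric.mem_ball_self hε)
  · exfalso
    obtain ⟨ε, hε, hball⟩ := Metric.eventually_nhds_iff_ball.1
      (hdiff.and (eventually_nhdsWithin_iff.1 hne))
    set R := min ε (min R₁ R₂) with hRdef
    have hR : 0 < R := lt_min hε (lt_min hR₁ hR₂)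
    have hRε : R ≤ ε := min_le_left _ _
    have hRR₁ : R ≤ R₁ := (min_le_right _ _).trans (min_le_left _ _)
    have hRR₂ : R ≤ R₂ := (min_le_right _ _).trans (min_le_right _ _)
    have hsub' : ∀ v, |v| < R → v ∈ abelRange P := fun v hv => hsub v (hv.trans_le hRR₂)
    have hmem : ∀ v ∈ Ioo 0 R, v ∈ Metric.ball (0 : ℝ) ε := fun v hv => by
      rw [Metric.mem_ball, dist_zero_right, Real.norm_eq_abs, abs_of_pos hv.1]
      exact hv.2.trans_le hRε
    have heq : abelPeriod P (R / 3) = abelPeriod P (R / 2) := by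
      rw [hper _ (by linarith) (by linarith), hper _ (by linarith) (by linarith)]
    have h1 : R / 3 ∈ Ioo 0 R := ⟨by linarith, by linarith⟩
    have h2 : R / 2 ∈ Ioo 0 R := ⟨by linarith, by linarith⟩
    rcases hasDerivWithinAt_forall_lt_or_forall_gt_of_forall_ne (convex_Ioo 0 R)
      (fun v hv => ((hball v (hmem v hv)).1.differentiableAt.hasDerivAt).hasDerivWithinAt)
      (fun v hv => (hball v (hmem v hv)).2 hv.1.ne') with hd | hd
    · exact (strictAntiOn_abelPeriod hP hsub' hd h1 h2 (by linarith)).ne heq.symm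
    · exact (strictMonoOn_abelPeriod hP hsub' hd h1 h2 (by linarith)).ne heq

theorem isIsochronousCenter_of_eventually_abelEven_eq_two (hP : P.coeff 0 = 0)
    (h : ∀ᶠ v in 𝓝 0, abelEven P v = 2) : IsIsochronousCenter (abelField P) (0, 0) := by
  refine ⟨isCenter_abelField hP, ∫ _ in (0 : ℝ)..Real.pi, 2, ?_⟩
  intro γ T hγ hsub
  obtain ⟨r, hr, H, rfl, rfl⟩ := hγ.eq_abelCircle hP fun q hq =>
    snd_mem_abelStrip_of_mem_periodAnnulus hP (hsub hq)
  -- Cycles of the annulus need not be small: the identity theorem spreads E = 2 over this symmetric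
  -- interval, which contains all the values r sin s.
  set U : Set ℝ := abelRange P ∩ Neg.neg ⁻¹' abelRange P with hU
  have hneg : (Neg.neg ⁻¹' abelRange P).OrdConnected :=
    ⟨fun x hx y hy z hz => (ordConnected_abelRange hP).out hy hx
      ⟨neg_le_neg hz.2, neg_le_neg hz.1⟩⟩
  have hpre : IsPreconnected U := ((ordConnected_abelRange hP).inter hneg).isPreconnected
  have heq : EqOn (abelEven P) (fun _ => 2) U :=
    AnalyticOnNhd.eqOn_of_preconnected_of_eventuallyEq
      (fun v hv => analyticAt_abelEven hP hv.1 hv.2) analyticOnNhd_const hpre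
      ⟨zero_mem_abelRange hP, by simpa using zero_mem_abelRange hP⟩ h
  rw [abelPeriod_eq_integral_abelEven hP H]
  exact intervalIntegral.integral_congr fun s _ => heq ⟨H s, neg_mul_sin_mem H s⟩

theorem isIsochronousCenter_iff (hP : P.coeff 0 = 0) :
    IsIsochronousCenter (abelField P) (0, 0) ↔ ∀ᶠ v in 𝓝 0, abelEven P v = 2 :=
  ⟨eventually_abelEven_eq_two_of_isIsochronousCenter hP,
    isIsochronousCenter_of_eventually_abelEven_eq_two hP⟩

theorem mul_abelPhi_pos (hP : P.coeff 0 = 0) {y : ℝ} (hy : y ∈ abelStrip P) (h0 : y ≠ 0) :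
    0 < y * abelPhi P y := by
  have hmono : StrictMonoOn (abelPhi P) (abelStrip P) := by
    refine strictMonoOn_of_deriv_pos ordConnected_abelStrip.convex
      (fun z hz => (hasDerivAt_abelPhi hP hz).continuousAt.continuousWithinAt) fun z hz => ?_
    have hz' := interior_subset hz
    rw [(hasDerivAt_abelPhi hP hz').deriv]
    exact one_div_pos.2 (one_add_eval_pos hz')
  have hφ0 : abelPhi P 0 = 0 := by simp [abelPhi]
  have hz := zero_mem_abelStrip hP
  rcases lt_or_gt_of_ne h0 with h | h
  · have := hmono hy hz h
    exact mul_pos_of_neg_of_neg h (by linarith)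
  · have := hmono hz hy h
    exact mul_pos h (by linarith)

/-- Substitute v = X(s): from X'(1 + P) = m(X), ds/(1 + P) = dv/m(v). With 1/m = 1 + h this is the
integral condition on a Urabe function. -/
theorem abelPhi_eq_integral (hP : P.coeff 0 = 0) {y : ℝ} (hy : y ∈ abelStrip P) :
    abelPhi P y = ∫ v in (0 : ℝ)..abelX P y, (abelSpeed P v)⁻¹ := by
  have hsub := ordConnected_abelStrip.uIcc_subset (zero_mem_abelStrip hP) hy
  have h := intervalIntegral.integral_comp_mul_deriv'' (a := 0) (b := y) (f := abelX P)
    (f' := deriv (abelX P)) (g := fun v => (abelSpeed P v)⁻¹) ((continuousOn_abelX hP).mono hsub)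
    (fun x hx => ((analyticAt_abelX hP
      (hsub (Ioo_subset_Icc_self hx))).differentiableAt.hasDerivAt).hasDerivWithinAt)
    (fun x hx => (analyticAt_abelX hP (hsub hx)).deriv.continuousAt.continuousWithinAt)
    (by
      rintro _ ⟨x, hx, rfl⟩
      have hm := abelX_mem_range (hsub hx)
      exact ((analyticAt_abelSpeed hP hm).continuousAt.inv₀
        (abelSpeed_pos hP hm).ne').continuousWithinAt)
  rw [abelX_zero] at h
  rw [← h, abelPhi]
  refine intervalIntegral.integral_congr fun x hx => ?_
  have hx' := hsub hx
  have h1 := deriv_abelX_mul hP hx'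
  have h2 := (one_add_eval_pos hx').ne'
  have h3 := (deriv_abelX_pos hP hx').ne'
  simp only [Function.comp]
  rw [← h1]
  field_simp

theorem exists_isAbelUrabeFunction (hP : P.coeff 0 = 0)
    (h : ∀ᶠ v in 𝓝 0, abelEven P v = 2) : ∃ k, IsAbelUrabeFunction P k := by
  obtain ⟨R, hR, hsub⟩ := exists_ball_subset_abelRange hP
  obtain ⟨ε', hε', hball⟩ := Metric.eventually_nhds_iff_ball.1 h
  obtain ⟨ε, hε, hεR, hεε'⟩ : ∃ ε, 0 < ε ∧ ε ≤ R ∧ ε ≤ ε' :=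
    ⟨min R ε', lt_min hR hε', min_le_left _ _, min_le_right _ _⟩
  have hmem : ∀ v, |v| < ε → v ∈ abelRange P := fun v hv => hsub v (hv.trans_le hεR)
  have heven : ∀ v, |v| < ε → (abelSpeed P v)⁻¹ + (abelSpeed P (-v))⁻¹ = 2 := fun v hv =>
    hball v (by simpa using hv.trans_le hεε')
  -- Oddness is required on all of ℝ but E = 2 is known only near 0, hence the cutoff to 0.
  set k : ℝ → ℝ := fun v => if |v| < ε then (abelSpeed P v)⁻¹ - 1 else 0 with hk
  have hk' : ∀ v, |v| < ε → k v = (abelSpeed P v)⁻¹ - 1 := fun v hv => by simp [hk, hv]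
  refine ⟨k, ?_, ?_⟩
  · intro v
    by_cases hv : |v| < ε
    · rw [hk' v hv, hk' (-v) (by rwa [abs_neg])]
      linarith [heven v hv]
    · simp [hk, hv]
  have hI := zero_mem_abelStrip hP
  have hXsmall : ∀ᶠ x in 𝓝 (0 : ℝ), |abelX P x| < ε := by
    have : ContinuousAt (fun x => |abelX P x|) 0 := (analyticAt_abelX hP hI).continuousAt.abs
    exact this.eventually_lt_const (by simpa [abelX_zero] using hε)
  filter_upwards [isOpen_abelStrip.mem_nhds hI, hXsmall] with x hx hXx
  have hm := abelSpeed_pos hP (hmem _ hXx)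
  have hsmall : ∀ v ∈ uIcc 0 (abelX P x), |v| < ε := fun v hv => by
    have := abs_sub_left_of_mem_uIcc hv
    simp only [sub_zero] at this
    exact this.trans_lt hXx
  have hcont : ContinuousOn (fun v => (abelSpeed P v)⁻¹) (uIcc 0 (abelX P x)) := fun v hv => by
    have hv' := hmem v (hsmall v hv)
    exact ((analyticAt_abelSpeed hP hv').continuousAt.inv₀
      (abelSpeed_pos hP hv').ne').continuousWithinAt
  have hcont' : ContinuousOn k (uIcc 0 (abelX P x)) :=
    (hcont.sub continuousOn_const).congr fun v hv => hk' v (hsmall v hv)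
  refine ⟨?_, ?_, hcont'.intervalIntegrable, ?_, fun h0 => ?_⟩
  · rw [hk' _ hXx]
    simpa using hm.ne'
  · rw [hk' _ hXx, add_sub_cancel, div_inv_eq_mul, abelX_mul_abelSpeed hP hx]
  · rw [abelPhi_eq_integral hP hx, intervalIntegral.integral_congr fun v hv => hk' v (hsmall v hv),
      intervalIntegral.integral_sub hcont.intervalIntegrable intervalIntegrable_const]
    simp
  · have h1 := mul_abelX_pos hP hx h0
    have h2 := mul_abelPhi_pos hP hx h0
    have h3 : 0 < x ^ 2 * (abelX P x * abelPhi P x) := by nlinarith [mul_pos h1 h2]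
    exact pos_of_mul_pos_right h3 (sq_nonneg x)

theorem IsAbelUrabeFunction.eventually_abelEven_eq_two (hP : P.coeff 0 = 0) {k : ℝ → ℝ}
    (hk : IsAbelUrabeFunction P k) : ∀ᶠ v in 𝓝 0, abelEven P v = 2 := by
  obtain ⟨hodd, hev⟩ := hk
  have h0 := zero_mem_abelRange hP
  have hY : Tendsto (abelY P) (𝓝 0) (𝓝 0) := by
    have := (analyticAt_abelY hP h0).continuousAt.tendsto
    rwa [abelY_zero hP] at this
  -- Put x = Y(v) = v m(v) in X/(1 + h(X)) = x and cancel v; oddness then makes the values at v and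
  -- -v add up to 2.
  have hkey : ∀ᶠ v in 𝓝 (0 : ℝ), v ≠ 0 → (abelSpeed P v)⁻¹ = 1 + k v := by
    filter_upwards [hY.eventually hev, (isOpen_abelRange hP).mem_nhds h0] with v hv hvJ hv0
    obtain ⟨h1, h2, -⟩ := hv
    rw [abelX_abelY hvJ] at h1 h2
    rw [← mul_abelSpeed hP, div_eq_iff h1, mul_assoc] at h2
    have h3 : abelSpeed P v * (1 + k v) = 1 := mul_left_cancel₀ hv0 (by linarith)
    exact inv_eq_of_mul_eq_one_right h3
  have hneg : Tendsto (fun v : ℝ => -v) (𝓝 0) (𝓝 0) := by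
    simpa using (continuous_neg (G := ℝ)).tendsto 0
  filter_upwards [hkey, hneg.eventually hkey] with v h1 h2
  rcases eq_or_ne v 0 with rfl | hv
  · exact abelEven_zero hP
  · rw [abelEven, h1 hv, h2 (neg_ne_zero.2 hv), hodd v]; ring

theorem abelX_neg (heven : ∀ y : ℝ, P.eval (-y) = P.eval y) (y : ℝ) :
    abelX P (-y) = -abelX P y := by
  have h : abelG P (-y) = abelG P y := by
    have := intervalIntegral.integral_comp_neg (a := 0) (b := y)
      (fun s => s / (1 + P.eval s))
    rw [neg_zero] at this
    rw [abelG, abelG, intervalIntegral.integral_symm, ← this, ← intervalIntegral.integral_neg]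
    simp [heven, neg_div]
  rw [abelX_eq, abelX_eq, h, Real.sign_neg, neg_mul]

/-- For even P, X is odd, so m takes equal values at ±X(y) and E = 2 forces m = 1. Then X(y) = y
near 0, and X X'(1 + P) = y becomes y P(y) = 0, giving P infinitely many roots. -/
theorem eq_zero_of_even_of_eventually_abelEven_eq_two (hP : P.coeff 0 = 0)
    (heven : ∀ y : ℝ, P.eval (-y) = P.eval y) (h : ∀ᶠ v in 𝓝 0, abelEven P v = 2) : P = 0 := by
  have hI := zero_mem_abelStrip hP
  have hX : Tendsto (abelX P) (𝓝 0) (𝓝 0) := by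
    have := (analyticAt_abelX hP hI).continuousAt.tendsto
    rwa [abelX_zero] at this
  have hneg : Tendsto (fun v : ℝ => -v) (𝓝 0) (𝓝 0) := by
    simpa using (continuous_neg (G := ℝ)).tendsto 0
  have hIn := isOpen_abelStrip.mem_nhds hI
  have hid : ∀ᶠ y in 𝓝 (0 : ℝ), abelX P y = y := by
    filter_upwards [hX.eventually h, hIn, hneg.eventually hIn] with y hy hyI hyI'
    rcases eq_or_ne y 0 with rfl | h0
    · exact abelX_zero
    have h1 := abelX_mul_abelSpeed hP hyI
    have h2 := abelX_mul_abelSpeed hP hyI'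
    have hne := abelX_ne_zero hP hyI h0
    rw [abelX_neg heven] at h2
    have h3 : abelSpeed P (-abelX P y) = abelSpeed P (abelX P y) :=
      mul_left_cancel₀ hne (by linarith)
    rw [abelEven, h3] at hy
    have h4 : abelSpeed P (abelX P y) = 1 := inv_eq_one.1 (by linarith)
    rw [h4, mul_one] at h1
    exact h1
  have hzero : ∀ᶠ y in 𝓝 (0 : ℝ), P.IsRoot y := by
    filter_upwards [hid.eventually_nhds, hIn] with y hy hyI
    rcases eq_or_ne y 0 with rfl | h0
    · rw [Polynomial.IsRoot, ← Polynomial.coeff_zero_eq_eval_zero, hP]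
    have h1 := abelX_mul_deriv hP hyI
    have h2 : deriv (abelX P) y = 1 := by
      rw [EventuallyEq.deriv_eq (f := fun y => y) hy]; simp
    rw [hy.self_of_nhds, h2, mul_one] at h1
    have h3 : y * P.eval y = 0 := by linarith
    exact (mul_eq_zero.1 h3).resolve_left h0
  exact Polynomial.eq_zero_of_infinite_isRoot P (infinite_of_mem_nhds 0 hzero)

theorem eventually_abelEven_zero_eq_two : ∀ᶠ v in 𝓝 0, abelEven (0 : Polynomial ℝ) v = 2 := by
  have hP : (0 : Polynomial ℝ).coeff 0 = 0 := by simp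
  have hX : ∀ y, abelX 0 y = y := by
    intro y
    have h : 2 * abelG 0 y = y ^ 2 := by simp [abelG]; ring
    rw [abelX_eq, h, Real.sqrt_sq_eq_abs]
    rcases lt_trichotomy y 0 with h | rfl | h
    · rw [Real.sign_of_neg h, abs_of_neg h]; ring
    · simp
    · rw [Real.sign_of_pos h, abs_of_pos h]; ring
  obtain ⟨R, hR, hsub⟩ := exists_ball_subset_abelRange hP
  have hspeed : ∀ v, |v| < R → abelSpeed 0 v = 1 := by
    intro v hv
    rcases eq_or_ne v 0 with rfl | h0
    · exact abelSpeed_zero hP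
    · refine mul_left_cancel₀ h0 ?_
      rw [mul_abelSpeed hP, ← hX (abelY 0 v), abelX_abelY (hsub v hv), mul_one]
  filter_upwards [Metric.ball_mem_nhds (0 : ℝ) hR] with v hv
  have hv' : |v| < R := by simpa using hv
  rw [abelEven, hspeed v hv', hspeed (-v) (by rwa [abs_neg])]
  norm_num

end Isochronous
end

theorem mainTheorem4 (P : Polynomial ℝ) (hP : P.coeff 0 = 0) :
    IsCenter (abelField P) (0, 0) ∧
    (0 < P.coeff 1 ^ 2 - 3 * P.coeff 2 → PeriodIncreasesNear (abelField P) (0, 0)) ∧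
    (P.coeff 1 ^ 2 - 3 * P.coeff 2 < 0 → PeriodDecreasesNear (abelField P) (0, 0)) ∧
    (IsIsochronousCenter (abelField P) (0, 0) ↔ ∃ h : ℝ → ℝ, IsAbelUrabeFunction P h) ∧
    ((∀ y : ℝ, P.eval (-y) = P.eval y) →
      (IsIsochronousCenter (abelField P) (0, 0) ↔ P = 0)) := by
  refine ⟨isCenter_abelField hP, fun h => ?_, fun h => ?_, ?_, fun heven => ?_⟩
  · obtain ⟨R, hR, hsub, hd⟩ := exists_pos_and_forall_deriv_abelEven_pos hP h
    exact periodIncreasesNear_of_strictMonoOn hP hR (strictMonoOn_abelPeriod hP hsub hd)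
  · obtain ⟨R, hR, hsub, hd⟩ := exists_pos_and_forall_deriv_abelEven_neg hP h
    exact periodDecreasesNear_of_strictAntiOn hP hR (strictAntiOn_abelPeriod hP hsub hd)
  · rw [isIsochronousCenter_iff hP]
    exact ⟨exists_isAbelUrabeFunction hP, fun ⟨_, hk⟩ => hk.eventually_abelEven_eq_two hP⟩
  · rw [isIsochronousCenter_iff hP]
    refine ⟨eq_zero_of_even_of_eventually_abelEven_eq_two hP heven, ?_⟩
    rintro rfl
    exact eventually_abelEven_zero_eq_two
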